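/- A \emph{girale} is an algebra $\langle A,\vee,\wedge,\to,\cdot,\neg,1,!\rangle$ such that $\langle A,\vee,\wedge,\to,\cdot,1\rangle$ is a commutative residuated lattice, and, with $0:=\neg 1$, $\neg a=a\to 0$ and $(a\to 0)\to 0=a$ for all $a$, and $!1=1$, $!a\le a\wedge 1$, $!a\cdot !b=!(a\wedge b)$, $!!a=!a$ for all $a,b$. For a girale $\mathbf A$ let $!A=\{!a:a\in A\}$ and let $!\mathbf A=\langle !A,\vee,\wedge_!,\to_!,\bot,1\rangle$, where $u\wedge_! v=!(u\wedge v)$, $u\to_! v=!(u\to v)$ and the constant $\bot$ is $!0$. For a class $\mathsf K$ of girales let $\mathrm{Heyt}(\mathsf K)$ be the class of (isomorphic copies of) the algebras $!\mathbf A$ with $\mathbf A\in\mathsf K$. A girale $\mathbf A$ is \emph{Boolean} if $!\mathbf A$ is a Boolean algebra. $\mathsf V(\mathbf A)$ is the variety generated by $\mathbf A$. Let $\mathbf G_1$ be the two-element Boolean algebra with $1=\top$, $0=\bot$, $x\cdot y=x\wedge y$ and $!x=x$. For $n\ge 2$ let $\mathbf G_n$ be the lattice of height three with bottom $\bot$,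 top $\top$ and $n$ atoms, two of which are named $1$ and $0$, with $\neg\bot=\top$, $\neg\top=\bot$, $\neg 1=0$, $\neg 0=1$ and $\neg a=a$ for every other element $a$; with $\bot\cdot a=a\cdot\bot=\bot$, $1\cdot a=a\cdot 1=a$, $a\cdot a=0$ for $a\notin\{0,1,\bot,\top\}$, and $a\cdot b=\top$ otherwise; with $a\to b=\neg(a\cdot\neg b)$; and with $!1=!\top=1$ and $!a=\bot$ otherwise. Then: 1. For every $n\ge1$, $\mathbf G_n$ is a finite simple Boolean girale, $|G_n|=n+2$ if $n\ge2$, and $\mathsf V(\mathbf G_n)$ is a variety of girales all of whose members are Boolean girales. 2. For $n\ge2$ the subdirectly irreducible algebras in $\mathsf V(\mathbf G_n)$ are, up to isomorphism, exactly the $\mathbf G_m$ with $2\le m\le n$; the only subdirectly irreducible algebra in $\mathsf V(\mathbf G_1)$ is, up to isomorphism, $\mathbf G_1$. 3. If $m,n\ge 1$ and $m\ne n$, then $\mathbf G_m\not\cong\mathbf G_n$ and $\mathsf V(\mathbf G_m)\neq\mathsf V(\mathbf G_n)$. So there are infinitely many pairwise nonisomorphic finite simple girales, which generate pairwise distinct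 varieties. 4. $\mathsf V(\mathbf G_1)$ and $\mathsf V(\mathbf G_2)$ are atoms of the lattice of varieties, and $\mathsf V(\mathbf G_1)\cap\mathsf V(\mathbf G_2)$ is the trivial variety, so that $\mathrm{Heyt}(\mathsf V(\mathbf G_1)\cap\mathsf V(\mathbf G_2))$ is the class of one-element algebras. But $\mathrm{Heyt}(\mathsf V(\mathbf G_1))=\mathrm{Heyt}(\mathsf V(\mathbf G_2))$ is the variety of all Boolean algebras. Hence $\mathrm{Heyt}(\mathsf V(\mathbf G_1)\cap\mathsf V(\mathbf G_2))\ne\mathrm{Heyt}(\mathsf V(\mathbf G_1))\cap\mathrm{Heyt}(\mathsf V(\mathbf G_2))$, and $\mathrm{Heyt}$ is not a meet-homomorphism on varieties of girales. -/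

import Mathlib

universe u

namespace Girales

/-! ## Universal algebra -/

/-- A type of (finitary) algebras: operation symbols with their arities. -/
structure AlgType where
  Op : Type
  arity : Op → ℕ

/-- An algebra of type `σ`. -/
structure UAlg (σ : AlgType) : Type (u + 1) where
  carrier : Type u
  op : (f : σ.Op) → (Fin (σ.arity f) → carrier) → carrier

variable {σ : AlgType}

/-- Homomorphisms of algebras. -/
def IsHom (A B : UAlg.{u} σ) (φ : A.carrier → B.carrier) : Prop :=
  ∀ (f : σ.Op) (x : Fin (σ.arity f) → A.carrier), φ (A.op f x) = B.op f (fun i => φ (x i))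

/-- `A` and `B` are isomorphic. -/
def Iso (A B : UAlg.{u} σ) : Prop :=
  ∃ φ : A.carrier → B.carrier, IsHom A B φ ∧ Function.Bijective φ

/-- The direct product of a family of algebras. -/
def prodAlg {ι : Type u} (A : ι → UAlg.{u} σ) : UAlg.{u} σ where
  carrier := ∀ i, (A i).carrier
  op f x := fun i => (A i).op f (fun j => x j i)

/-- A class of algebras is a variety if it is closed under homomorphic images, under
(isomorphic copies of) subalgebras, and under direct products. -/
structure IsVariety (K : Set (UAlg.{u} σ)) : Prop where
  closed_H : ∀ A ∈ K, ∀ B : UAlg.{u} σ,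
    (∃ φ : A.carrier → B.carrier, IsHom A B φ ∧ Function.Surjective φ) → B ∈ K
  closed_S : ∀ A ∈ K, ∀ B : UAlg.{u} σ,
    (∃ φ : B.carrier → A.carrier, IsHom B A φ ∧ Function.Injective φ) → B ∈ K
  closed_P : ∀ (ι : Type u) (A : ι → UAlg.{u} σ), (∀ i, A i ∈ K) → prodAlg A ∈ K

/-- The variety generated by an algebra: the smallest variety containing it. -/
def V (A : UAlg.{u} σ) : Set (UAlg.{u} σ) :=
  {B | ∀ W : Set (UAlg.{u} σ), IsVariety W → A ∈ W → B ∈ W}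

/-- The trivial class (one-element algebras, if the type has a constant). -/
def trivialClass (σ : AlgType) : Set (UAlg.{u} σ) := {A | Subsingleton A.carrier}

/-- Atoms of the lattice of varieties: nontrivial varieties whose only proper subvariety is
the trivial one. -/
def IsAtomVariety (K : Set (UAlg.{u} σ)) : Prop :=
  IsVariety K ∧ K ≠ trivialClass σ ∧
    ∀ W : Set (UAlg.{u} σ), IsVariety W → W ⊆ K → W = trivialClass σ ∨ W = K

/-- Congruences of an algebra. -/
def IsCongruence (A : UAlg.{u} σ) (θ : Setoid A.carrier) : Prop :=
  ∀ (f : σ.Op) (x y : Fin (σ.arity f) → A.carrier), (∀ i, θ (x i) (y i)) → θ (A.op f x) (A.op f y)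

/-- An algebra is simple if it is nontrivial and has no congruences except the identity and the
total relation. -/
def IsSimpleAlg (A : UAlg.{u} σ) : Prop :=
  Nontrivial A.carrier ∧ ∀ θ : Setoid A.carrier, IsCongruence A θ → θ = ⊥ ∨ θ = ⊤

/-- An algebra is subdirectly irreducible if it has a least congruence among those different
from the identity. (One-element algebras are not subdirectly irreducible.) -/
def IsSubdirectlyIrreducible (A : UAlg.{u} σ) : Prop :=
  ∃ μ : Setoid A.carrier, IsCongruence A μ ∧ μ ≠ ⊥ ∧
    ∀ θ : Setoid A.carrier, IsCongruence A θ → θ ≠ ⊥ → μ ≤ θ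

/-! ## Girales -/

/-- The operation symbols of girales. -/
inductive GiraleOp
  | join | meet | imp | mul | neg | one | bang

/-- The type of girales. -/
def giraleType : AlgType where
  Op := GiraleOp
  arity f := match f with
    | .join => 2
    | .meet => 2
    | .imp => 2
    | .mul => 2
    | .neg => 1
    | .one => 0
    | .bang => 1

/-- The algebra of the type of girales with given operations. -/
def mkGiraleAlg (α : Type u) (join meet imp mul : α → α → α) (neg : α → α) (one : α)
    (bang : α → α) : UAlg.{u} giraleType where
  carrier := α
  op f := match f with
    | .join => fun x : Fin 2 → α => join (x 0) (x 1)
    | .meet => fun x : Fin 2 → α => meet (x 0) (x 1)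
    | .imp => fun x : Fin 2 → α => imp (x 0) (x 1)
    | .mul => fun x : Fin 2 → α => mul (x 0) (x 1)
    | .neg => fun x : Fin 1 → α => neg (x 0)
    | .one => fun _ => one
    | .bang => fun x : Fin 1 → α => bang (x 0)

section ops

variable (A : UAlg.{u} giraleType)

def join (a b : A.carrier) : A.carrier := A.op GiraleOp.join ![a, b]
def meet (a b : A.carrier) : A.carrier := A.op GiraleOp.meet ![a, b]
def imp (a b : A.carrier) : A.carrier := A.op GiraleOp.imp ![a, b]
def mul (a b : A.carrier) : A.carrier := A.op GiraleOp.mul ![a, b]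
def neg (a : A.carrier) : A.carrier := A.op GiraleOp.neg ![a]
def one : A.carrier := A.op GiraleOp.one ![]
def bang (a : A.carrier) : A.carrier := A.op GiraleOp.bang ![a]

/-- The constant `0 = ¬ 1`. -/
def zero : A.carrier := neg A (one A)

/-- The lattice order. -/
def le (a b : A.carrier) : Prop := meet A a b = a

/-- Girales: Girard algebras (commutative residuated lattices in which `0` is an involutive
element and `¬ a = a → 0`) with a unary operation `!` that satisfies `!1 = 1`, `!a ≤ a ∧ 1`,
`!a · !b = !(a ∧ b)` and `!!a = !a`. -/
structure IsGirale : Prop where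
  join_comm : ∀ a b, join A a b = join A b a
  join_assoc : ∀ a b c, join A (join A a b) c = join A a (join A b c)
  meet_comm : ∀ a b, meet A a b = meet A b a
  meet_assoc : ∀ a b c, meet A (meet A a b) c = meet A a (meet A b c)
  join_meet_self : ∀ a b, join A a (meet A a b) = a
  meet_join_self : ∀ a b, meet A a (join A a b) = a
  mul_comm : ∀ a b, mul A a b = mul A b a
  mul_assoc : ∀ a b c, mul A (mul A a b) c = mul A a (mul A b c)
  one_mul : ∀ a, mul A (one A) a = a
  residuation : ∀ a b c, le A (mul A a b) c ↔ le A a (imp A b c)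
  involutive : ∀ a, imp A (imp A a (zero A)) (zero A) = a
  neg_eq : ∀ a, neg A a = imp A a (zero A)
  bang_one : bang A (one A) = one A
  bang_le : ∀ a, le A (bang A a) (meet A a (one A))
  bang_mul_bang : ∀ a b, mul A (bang A a) (bang A b) = bang A (meet A a b)
  bang_bang : ∀ a, bang A (bang A a) = bang A a

variable {A}

/-- The image of `!` in a girale is closed under joins. -/
theorem IsGirale.bang_join_bang (h : IsGirale A) (a b : A.carrier) :
    bang A (join A (bang A a) (bang A b)) = join A (bang A a) (bang A b) := by
  have refl : ∀ x, le A x x := fun x => by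
    have h1 := h.meet_join_self x (meet A x x)
    rw [h.join_meet_self] at h1
    exact h1
  have trans : ∀ x y z, le A x y → le A y z → le A x z := fun x y z h1 h2 => by
    simp only [le] at *
    rw [← h1, h.meet_assoc, h2]
  have antisymm : ∀ x y, le A x y → le A y x → x = y := fun x y h1 h2 => by
    simp only [le] at *
    rw [← h1, h.meet_comm, h2]
  have left : ∀ x y, le A (meet A x y) x := fun x y => by
    have h2 : meet A x x = x := refl x
    simp only [le]
    rw [h.meet_comm, ← h.meet_assoc, h2]
  have right : ∀ x y, le A (meet A x y) y := fun x y => by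
    rw [h.meet_comm]; exact left y x
  have jl : ∀ x y, le A x (join A x y) := h.meet_join_self
  have jr : ∀ x y, le A y (join A x y) := fun x y => by
    rw [h.join_comm]; exact jl y x
  have le_iff : ∀ x y, le A x y → join A x y = y := fun x y h1 => by
    simp only [le] at h1
    rw [← h1, h.meet_comm, h.join_comm, h.join_meet_self]
  have jle : ∀ x y z, le A x z → le A y z → le A (join A x y) z := fun x y z h1 h2 => by
    have h3 : join A (join A x y) z = z := by
      rw [h.join_assoc, le_iff _ _ h2, le_iff _ _ h1]
    have h4 := h.meet_join_self (join A x y) z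
    rw [h3] at h4
    exact h4
  have mulmono : ∀ x y z, le A x y → le A (mul A x z) (mul A y z) := fun x y z h1 =>
    (h.residuation _ _ _).2 (trans _ _ _ h1 ((h.residuation _ _ _).1 (refl _)))
  have mono : ∀ x y, le A x y → le A (bang A x) (bang A y) := fun x y h1 => by
    have h2 := mulmono _ _ (bang A y) (trans _ _ _ (h.bang_le x) (right _ _))
    rw [h.one_mul, h.bang_mul_bang] at h2
    simp only [le] at h1
    rw [h1] at h2
    exact h2
  apply antisymm
  · exact trans _ _ _ (h.bang_le _) (left _ _)
  · apply jle
    · have h1 := mono _ _ (jl (bang A a) (bang A b))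
      rwa [h.bang_bang] at h1
    · have h1 := mono _ _ (jr (bang A a) (bang A b))
      rwa [h.bang_bang] at h1

end ops

/-! ## Heyting algebras and the operator `Heyt` -/

/-- The operation symbols of (pointed) Heyting algebras. -/
inductive HeytOp
  | join | meet | imp | bot | one

/-- The type of (pointed) Heyting algebras. -/
def heytType : AlgType where
  Op := HeytOp
  arity f := match f with
    | .join => 2
    | .meet => 2
    | .imp => 2
    | .bot => 0
    | .one => 0

/-- The algebra `!A = ⟨!A, ∨, ∧_!, →_!, ⊥, 1⟩` of a girale `A`, where `!A = {!a : a ∈ A}`,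
`u ∧_! v = !(u ∧ v)`, `u →_! v = !(u → v)`, and where the constant `⊥` is `!0`. -/
def bangAlg (A : UAlg.{u} giraleType) (h : IsGirale A) : UAlg.{u} heytType where
  carrier := {a : A.carrier // ∃ b, bang A b = a}
  op f := match f with
    | .join => fun x : Fin 2 → {a : A.carrier // ∃ b, bang A b = a} =>
        ⟨join A (x 0).1 (x 1).1, join A (x 0).1 (x 1).1, by
          obtain ⟨a, ha⟩ := (x 0).2
          obtain ⟨b, hb⟩ := (x 1).2
          rw [← ha, ← hb]
          exact h.bang_join_bang a b⟩
    | .meet => fun x : Fin 2 → {a : A.carrier // ∃ b, bang A b = a} =>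
        ⟨bang A (meet A (x 0).1 (x 1).1), _, rfl⟩
    | .imp => fun x : Fin 2 → {a : A.carrier // ∃ b, bang A b = a} =>
        ⟨bang A (imp A (x 0).1 (x 1).1), _, rfl⟩
    | .bot => fun _ => ⟨bang A (zero A), _, rfl⟩
    | .one => fun _ => ⟨one A, one A, h.bang_one⟩

section hops

variable (B : UAlg.{u} heytType)

def hjoin (a b : B.carrier) : B.carrier := B.op HeytOp.join ![a, b]
def hmeet (a b : B.carrier) : B.carrier := B.op HeytOp.meet ![a, b]
def himp (a b : B.carrier) : B.carrier := B.op HeytOp.imp ![a, b]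
def hbot : B.carrier := B.op HeytOp.bot ![]
def hone : B.carrier := B.op HeytOp.one ![]
def hle (a b : B.carrier) : Prop := hmeet B a b = a

/-- Heyting algebras: bounded lattices in which `→` is the residual of the meet. -/
structure IsHeyting : Prop where
  join_comm : ∀ a b, hjoin B a b = hjoin B b a
  join_assoc : ∀ a b c, hjoin B (hjoin B a b) c = hjoin B a (hjoin B b c)
  meet_comm : ∀ a b, hmeet B a b = hmeet B b a
  meet_assoc : ∀ a b c, hmeet B (hmeet B a b) c = hmeet B a (hmeet B b c)
  join_meet_self : ∀ a b, hjoin B a (hmeet B a b) = a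
  meet_join_self : ∀ a b, hmeet B a (hjoin B a b) = a
  bot_le : ∀ a, hle B (hbot B) a
  le_one : ∀ a, hle B a (hone B)
  residuation : ∀ a b c, hle B (hmeet B a b) c ↔ hle B a (himp B b c)

/-- Boolean algebras: Heyting algebras that satisfy `a ∨ (a → ⊥) = 1`. -/
def IsBooleanAlg : Prop :=
  IsHeyting B ∧ ∀ a, hjoin B a (himp B a (hbot B)) = hone B

end hops

/-- The class of Boolean algebras. -/
def BooleanAlgs : Set (UAlg.{u} heytType) := {B | IsBooleanAlg B}

/-- `Heyt(K)`: the algebras (isomorphic to) `!A`, for a girale `A` in `K`. -/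
def Heyt (K : Set (UAlg.{u} giraleType)) : Set (UAlg.{u} heytType) :=
  {B | ∃ A ∈ K, ∃ h : IsGirale A, Iso B (bangAlg A h)}

/-- Boolean girales: girales `A` for which `!A` is a Boolean algebra. -/
def IsBooleanGirale (A : UAlg.{u} giraleType) : Prop :=
  ∃ h : IsGirale A, IsBooleanAlg (bangAlg A h)

/-- Varieties of girales. -/
def IsGiraleVariety (K : Set (UAlg.{u} giraleType)) : Prop :=
  IsVariety K ∧ ∀ A ∈ K, IsGirale A

/-! ## The algebras `G n` -/

/-- The elements of the height-three lattice with the `k + 2` atoms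
`1`, `0` and `mid i` (`i < k`). -/
inductive GElt (k : ℕ) : Type u
  | bot | top | one | zero
  | mid (i : Fin k)
  deriving DecidableEq

namespace GElt

variable {k : ℕ}

/-- Two distinct elements, neither of which is the bottom, have join `⊤`. -/
def join (x y : GElt.{u} k) : GElt.{u} k :=
  if x = y then x else if x = bot then y else if y = bot then x else top

/-- Two distinct elements, neither of which is the top, have meet `⊥`. -/
def meet (x y : GElt.{u} k) : GElt.{u} k :=
  if x = y then x else if x = top then y else if y = top then x else bot

def neg : GElt.{u} k → GElt.{u} k
  | bot => top
  | top => bot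
  | one => zero
  | zero => one
  | mid i => mid i

def mul : GElt.{u} k → GElt.{u} k → GElt.{u} k
  | bot, _ => bot
  | _, bot => bot
  | one, y => y
  | x, one => x
  | mid i, mid j => if i = j then zero else top
  | _, _ => top

/-- `x → y = ¬ (x · ¬ y)`. -/
def imp (x y : GElt.{u} k) : GElt.{u} k := neg (mul x (neg y))

def bang : GElt.{u} k → GElt.{u} k
  | one => one
  | top => one
  | _ => bot

end GElt

/-- The two-element Boolean algebra, with `1 = ⊤`, `0 = ⊥`, `x · y = x ∧ y` and `!x = x`. -/
def twoAlg : UAlg.{u} giraleType :=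
  mkGiraleAlg (ULift.{u} Bool)
    (fun x y => ⟨x.down || y.down⟩) (fun x y => ⟨x.down && y.down⟩)
    (fun x y => ⟨!x.down || y.down⟩) (fun x y => ⟨x.down && y.down⟩)
    (fun x => ⟨!x.down⟩) ⟨true⟩ (fun x => x)

/-- The algebra `G n`, for `n ≥ 1`: the two-element Boolean algebra if `n = 1`, and the
height-three lattice with `n` atoms, with the operations above, if `n ≥ 2`.
(The value at `n = 0` is irrelevant.) -/
def G : ℕ → UAlg.{u} giraleType
  | k + 2 => mkGiraleAlg (GElt.{u} k) GElt.join GElt.meet GElt.imp GElt.mul GElt.neg GElt.one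
      GElt.bang
  | _ => twoAlg

end Girales

open Girales

/-!
In a girale, `x = y` if and only if `!((x → y) ∧ (y → x)) = 1`. If `!` takes only the two values
`1 ≠ !0`, the left-hand term is an equality test. A homomorphism identifying two distinct points
then identifies `1` with `!0`, hence is constant, so the girale is simple. If such a girale `C` is
finite and `A` is separated by homomorphisms into `C`, then so is every quotient of `A`: finitely
many identifications are summed up in the value of one equality test, and compactness of the set of
homomorphisms from `A` to `C` extends this to all identifications. Hence `V C = ISP C`,
whose subdirectly irreducible members are the subalgebras of `C` up to isomorphism.

For such a `C`, the algebra `!A` is Boolean for every `A` in `V C`, and each Boolean algebra is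
obtained from the corresponding Boolean power of `C`. All this applies to `G n`. For `n ≥ 2` its
subalgebras are obtained by deleting atoms other than `1` and `0`, and `G 1` has no proper
subalgebra.
-/

namespace Girales

/-! ## Congruences, products and separation by homomorphisms -/

section UniversalAlgebra

variable {σ : AlgType} {A B C : UAlg.{u} σ}

theorem IsHom.comp {φ : A.carrier → B.carrier} {ψ : B.carrier → C.carrier}
    (hψ : IsHom B C ψ) (hφ : IsHom A B φ) : IsHom A C (ψ ∘ φ) := fun f x =>
  (congrArg ψ (hφ f x)).trans (hψ f _)

theorem IsHom.of_jointly_injective {ι : Type*} {φ : A.carrier → B.carrier}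
    {ψ : ι → B.carrier → C.carrier} (hψ : ∀ i, IsHom B C (ψ i))
    (inj : ∀ x y, (∀ i, ψ i x = ψ i y) → x = y) (h : ∀ i, IsHom A C (ψ i ∘ φ)) : IsHom A B φ :=
  fun f x => inj _ _ fun i => (h i f x).trans (hψ i f _).symm

theorem IsHom.of_comp_surjective {φ : A.carrier → B.carrier} {ψ : B.carrier → C.carrier}
    (hφ : IsHom A B φ) (surj : Function.Surjective φ) (h : IsHom A C (ψ ∘ φ)) : IsHom B C ψ := by
  intro f y
  obtain ⟨x, rfl⟩ := surj.comp_left y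
  exact (congrArg ψ (hφ f x)).symm.trans (h f x)

theorem isHom_prodAlg_proj {ι : Type u} (A : ι → UAlg.{u} σ) (i : ι) :
    IsHom (prodAlg A) (A i) (fun x => x i) := fun _ _ => rfl

theorem iso_of_range_eq {φ : A.carrier → C.carrier} {ψ : B.carrier → C.carrier}
    (hφ : IsHom A C φ) (iφ : Function.Injective φ) (hψ : IsHom B C ψ) (iψ : Function.Injective ψ)
    (hrange : Set.range φ = Set.range ψ) : Iso A B := by
  have lift_exists : ∀ a, ∃ b, ψ b = φ a := fun a => hrange.le ⟨a, rfl⟩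
  choose χ hχ using lift_exists
  have comp_eq : ψ ∘ χ = φ := funext hχ
  refine ⟨χ, .of_jointly_injective (fun _ : Unit => hψ) (fun _ _ h => iψ (h ()))
    fun _ => comp_eq ▸ hφ, .of_comp (comp_eq ▸ iφ : (ψ ∘ χ).Injective), fun b => ?_⟩
  obtain ⟨a, ha⟩ := hrange.ge ⟨b, rfl⟩
  exact ⟨a, iψ ((hχ a).trans ha)⟩

theorem Iso.card_eq (h : Iso A B) : Nat.card A.carrier = Nat.card B.carrier :=
  let ⟨φ, _, hφ⟩ := h
  Nat.card_eq_of_bijective φ hφ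

theorem isVariety_V (A : UAlg.{u} σ) : IsVariety (V A) where
  closed_H B hB C h W hW hA := hW.closed_H B (hB W hW hA) C h
  closed_S B hB C h W hW hA := hW.closed_S B (hB W hW hA) C h
  closed_P ι B hB W hW hA := hW.closed_P ι B fun i => hB i W hW hA

theorem mem_V_self (A : UAlg.{u} σ) : A ∈ V A := fun _ _ h => h

theorem V_subset {K : Set (UAlg.{u} σ)} (hK : IsVariety K) (hA : A ∈ K) : V A ⊆ K :=
  fun _ hB => hB K hK hA

theorem IsVariety.mem_of_iso {K : Set (UAlg.{u} σ)} (hK : IsVariety K) (hB : B ∈ K)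
    (h : Iso A B) : A ∈ K :=
  let ⟨φ, hφ, bij⟩ := h
  hK.closed_S B hB A ⟨φ, hφ, bij.injective⟩

theorem IsVariety.inter {K L : Set (UAlg.{u} σ)} (hK : IsVariety K) (hL : IsVariety L) :
    IsVariety (K ∩ L) where
  closed_H A hA B h := ⟨hK.closed_H A hA.1 B h, hL.closed_H A hA.2 B h⟩
  closed_S A hA B h := ⟨hK.closed_S A hA.1 B h, hL.closed_S A hA.2 B h⟩
  closed_P ι A hA := ⟨hK.closed_P ι A fun i => (hA i).1, hL.closed_P ι A fun i => (hA i).2⟩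

-- The empty product is a one-element algebra.
theorem IsVariety.trivialClass_subset {K : Set (UAlg.{u} σ)} (hK : IsVariety K) :
    trivialClass σ ⊆ K := fun A hA =>
  have : Subsingleton A.carrier := hA
  hK.closed_S _ (hK.closed_P PEmpty (fun i => i.elim) fun i => i.elim) A
    ⟨fun _ i => i.elim, fun _ _ => funext fun i => i.elim, Function.injective_of_subsingleton _⟩

theorem IsAtomVariety.inter_eq_trivialClass {K L : Set (UAlg.{u} σ)} (hK : IsAtomVariety K)
    (hL : IsAtomVariety L) (hne : K ≠ L) : K ∩ L = trivialClass σ := by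
  refine (hK.2.2 _ (hK.1.inter hL.1) Set.inter_subset_left).resolve_right fun h => ?_
  exact (hL.2.2 K hK.1 (Set.inter_eq_left.1 h)).elim hK.2.1 hne

theorem isCongruence_ker {φ : A.carrier → B.carrier} (h : IsHom A B φ) :
    IsCongruence A (Setoid.ker φ) := fun f x y hxy =>
  (h f x).trans ((congrArg (B.op f) (funext hxy)).trans (h f y).symm)

/-- The quotient of an algebra by an equivalence relation, with operations evaluated at chosen
representatives; it is meaningful when the relation is a congruence. -/
noncomputable def quotientAlg (A : UAlg.{u} σ) (θ : Setoid A.carrier) : UAlg.{u} σ where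
  carrier := Quotient θ
  op f x := ⟦A.op f fun i => (x i).out⟧

theorem isHom_quotientAlg_mk {θ : Setoid A.carrier} (hθ : IsCongruence A θ) :
    IsHom A (quotientAlg A θ) (Quotient.mk θ) := fun f x =>
  Quotient.sound (hθ f _ _ fun i => θ.symm (Quotient.mk_out (x i)))

theorem isSimpleAlg_of_forall_isHom [Nontrivial A.carrier]
    (h : ∀ (B : UAlg.{u} σ) (φ : A.carrier → B.carrier), IsHom A B φ →
      Function.Injective φ ∨ ∀ x y, φ x = φ y) : IsSimpleAlg A := by
  refine ⟨inferInstance, fun θ hθ => ?_⟩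
  refine (h _ _ (isHom_quotientAlg_mk hθ)).imp (fun inj => ?_) fun const => ?_
  · exact le_bot_iff.1 fun x y hxy => inj (Quotient.sound hxy)
  · exact top_le_iff.1 fun x y _ => Quotient.exact (const x y)

theorem IsSimpleAlg.isSubdirectlyIrreducible (h : IsSimpleAlg A) : IsSubdirectlyIrreducible A := by
  obtain ⟨⟨x, y, hxy⟩, eq_bot_or_top⟩ := h
  exact ⟨⊤, fun _ _ _ _ => trivial, fun top_eq_bot => hxy (top_eq_bot.le trivial),
    fun θ hθ hne => ((eq_bot_or_top θ hθ).resolve_left hne).ge⟩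

/-- `ISP C` is the class of algebras whose points are separated by homomorphisms into `C`; these
are the isomorphic copies of subalgebras of powers of `C`. -/
def ISP (C : UAlg.{u} σ) : Set (UAlg.{u} σ) :=
  {A | ∀ x y : A.carrier, (∀ φ, IsHom A C φ → φ x = φ y) → x = y}

theorem mem_ISP_self (C : UAlg.{u} σ) : C ∈ ISP C := fun _ _ h => h id fun _ _ => rfl

theorem exists_isHom_of_mem_ISP (hA : A ∈ ISP C) {x y : A.carrier} (hxy : x ≠ y) :
    ∃ φ, IsHom A C φ ∧ φ x ≠ φ y := by
  by_contra! hall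
  exact hxy (hA x y hall)

theorem mem_ISP_of_injective (hA : A ∈ ISP C) {φ : B.carrier → A.carrier} (hφ : IsHom B A φ)
    (inj : Function.Injective φ) : B ∈ ISP C := fun _ _ h =>
  inj (hA _ _ fun _ hψ => h _ (hψ.comp hφ))

theorem prodAlg_mem_ISP {ι : Type u} {A : ι → UAlg.{u} σ} (hA : ∀ i, A i ∈ ISP C) :
    prodAlg A ∈ ISP C := fun _ _ h =>
  funext fun i => hA i _ _ fun _ hψ => h _ (hψ.comp (isHom_prodAlg_proj A i))

theorem ISP_subset_V (C : UAlg.{u} σ) : ISP C ⊆ V C := fun A hA _ hW hC =>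
  hW.closed_S _ (hW.closed_P {φ // IsHom A C φ} (fun _ => C) fun _ => hC) A
    ⟨fun a φ => φ.1 a, fun f x => funext fun φ => φ.2 f x,
      fun x y hxy => hA x y fun φ hφ => congrFun hxy ⟨φ, hφ⟩⟩

theorem isVariety_ISP (hH : ∀ (A B : UAlg.{u} σ) (φ : A.carrier → B.carrier), A ∈ ISP C →
    IsHom A B φ → Function.Surjective φ → B ∈ ISP C) : IsVariety (ISP C) where
  closed_H A hA B := fun ⟨φ, hφ, surj⟩ => hH A B φ hA hφ surj
  closed_S _ hA _ := fun ⟨_, hφ, inj⟩ => mem_ISP_of_injective hA hφ inj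
  closed_P _ _ hA := prodAlg_mem_ISP hA

theorem IsSubdirectlyIrreducible.exists_embedding (hA : IsSubdirectlyIrreducible A)
    (hAC : A ∈ ISP C) : ∃ φ, IsHom A C φ ∧ Function.Injective φ := by
  obtain ⟨μ, _, μ_ne_bot, μ_le⟩ := hA
  by_contra! not_injective
  refine μ_ne_bot (le_bot_iff.1 fun x y hxy => hAC x y fun φ hφ => ?_)
  exact μ_le _ (isCongruence_ker hφ)
    (fun h => not_injective φ hφ (Setoid.injective_iff_ker_bot φ |>.2 h)) hxy

theorem card_eq_of_V_eq [Finite A.carrier] [Finite B.carrier] (hA : IsSubdirectlyIrreducible A)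
    (hB : IsSubdirectlyIrreducible B) (hVA : V A = ISP A) (hVB : V B = ISP B) (h : V A = V B) :
    Nat.card A.carrier = Nat.card B.carrier := by
  obtain ⟨φ, _, iφ⟩ := hA.exists_embedding (hVB ▸ h ▸ mem_V_self A : A ∈ ISP B)
  obtain ⟨ψ, _, iψ⟩ := hB.exists_embedding (hVA ▸ h ▸ mem_V_self B : B ∈ ISP A)
  exact (Nat.card_le_card_of_injective φ iφ).antisymm (Nat.card_le_card_of_injective ψ iψ)

theorem isAtomVariety_V [Nontrivial C.carrier] (hV : V C = ISP C)
    (hsurj : ∀ (A : UAlg.{u} σ) (φ : A.carrier → C.carrier), IsHom A C φ →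
      Function.Surjective φ) : IsAtomVariety (V C) := by
  refine ⟨isVariety_V C, fun h => ?_, fun W hW hWC => or_iff_not_imp_left.2 fun hne => ?_⟩
  · exact not_subsingleton C.carrier (h ▸ mem_V_self C : C ∈ trivialClass σ)
  · obtain ⟨A, hAW, hA⟩ := Set.not_subset.1 fun h => hne (h.antisymm hW.trivialClass_subset)
    obtain ⟨x, y, hxy⟩ := not_subsingleton_iff_nontrivial.1 hA
    obtain ⟨φ, hφ, _⟩ := exists_isHom_of_mem_ISP (hV ▸ hWC hAW) hxy
    exact hWC.antisymm (V_subset hW (hW.closed_H A hAW C ⟨φ, hφ, hsurj A φ hφ⟩))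

theorem isClosed_setOf_isHom [TopologicalSpace C.carrier] [DiscreteTopology C.carrier] :
    IsClosed {φ | IsHom A C φ} := by
  simp only [IsHom, Set.ofPred_forall]
  refine isClosed_iInter fun f => isClosed_iInter fun x => ?_
  exact isClosed_eq (continuous_apply _)
    (continuous_of_discreteTopology.comp (continuous_pi fun i => continuous_apply (x i)))

-- Tychonoff: the homomorphisms form a closed subset of the compact space of all maps.
theorem exists_isHom_of_forall_finset [Finite C.carrier] {E : Set (A.carrier × A.carrier)}
    {x y : A.carrier}
    (hfin : ∀ s : Finset (A.carrier × A.carrier), ↑s ⊆ E →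
      ∃ φ, IsHom A C φ ∧ (∀ p ∈ s, φ p.1 = φ p.2) ∧ φ x ≠ φ y) :
    ∃ φ, IsHom A C φ ∧ (∀ p ∈ E, φ p.1 = φ p.2) ∧ φ x ≠ φ y := by
  let _ : TopologicalSpace C.carrier := ⊥
  have : DiscreteTopology C.carrier := ⟨rfl⟩
  have isClosed_setOf_ne : IsClosed {φ : A.carrier → C.carrier | φ x ≠ φ y} :=
    (isClosed_discrete {c : C.carrier × C.carrier | c.1 ≠ c.2}).preimage
      (f := fun φ : A.carrier → C.carrier => (φ x, φ y)) (by fun_prop)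
  have isCompact_inter := (isClosed_setOf_isHom.inter isClosed_setOf_ne).isCompact
  obtain ⟨φ, ⟨hφ, hxy⟩, hE⟩ := isCompact_inter.inter_iInter_nonempty
    (fun p : E => {φ | φ p.1.1 = φ p.1.2})
    (fun _ => isClosed_eq (continuous_apply _) (continuous_apply _)) fun s => by
      obtain ⟨φ, hφ, hs, hxy⟩ := hfin (s.map (.subtype _)) (by simp)
      exact ⟨φ, ⟨hφ, hxy⟩, Set.mem_iInter₂.2 fun p hp =>
        hs p (Finset.mem_map_of_mem (.subtype _) hp)⟩
  exact ⟨φ, hφ, fun p hp => Set.mem_iInter.1 hE ⟨p, hp⟩, hxy⟩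

theorem mem_ISP_of_surjective [Finite C.carrier] {φ : A.carrier → B.carrier} (hφ : IsHom A B φ)
    (surj : Function.Surjective φ)
    (hsep : ∀ s : Finset (A.carrier × A.carrier), (∀ p ∈ s, φ p.1 = φ p.2) →
      ∀ x y, φ x ≠ φ y → ∃ ψ, IsHom A C ψ ∧ (∀ p ∈ s, ψ p.1 = ψ p.2) ∧ ψ x ≠ ψ y) :
    B ∈ ISP C := by
  refine surj.forall₂.2 fun x y hxy => by_contra fun hne => ?_
  obtain ⟨ψ, hψ, ker_le, hψxy⟩ := exists_isHom_of_forall_finset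
    (E := {p | φ p.1 = φ p.2}) fun s hs => hsep s hs x y hne
  obtain ⟨χ, rfl⟩ : ∃ χ, χ ∘ φ = ψ :=
    ⟨fun b => ψ (surj b).choose, funext fun a => ker_le (_, a) (surj (φ a)).choose_spec⟩
  exact hψxy (hxy χ (hφ.of_comp_surjective surj hψ))

end UniversalAlgebra

/-! ## Homomorphisms of girales and of Heyting algebras -/

section GiraleHom

variable {A B : UAlg.{u} giraleType} {φ : A.carrier → B.carrier} (h : IsHom A B φ)
include h

theorem IsHom.map_join (a b : A.carrier) : φ (join A a b) = join B (φ a) (φ b) :=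
  (h GiraleOp.join ![a, b]).trans (congrArg (B.op GiraleOp.join) (FinVec.map_eq φ ![a, b]).symm)

theorem IsHom.map_meet (a b : A.carrier) : φ (meet A a b) = meet B (φ a) (φ b) :=
  (h GiraleOp.meet ![a, b]).trans (congrArg (B.op GiraleOp.meet) (FinVec.map_eq φ ![a, b]).symm)

theorem IsHom.map_imp (a b : A.carrier) : φ (imp A a b) = imp B (φ a) (φ b) :=
  (h GiraleOp.imp ![a, b]).trans (congrArg (B.op GiraleOp.imp) (FinVec.map_eq φ ![a, b]).symm)

theorem IsHom.map_mul (a b : A.carrier) : φ (mul A a b) = mul B (φ a) (φ b) :=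
  (h GiraleOp.mul ![a, b]).trans (congrArg (B.op GiraleOp.mul) (FinVec.map_eq φ ![a, b]).symm)

theorem IsHom.map_neg (a : A.carrier) : φ (neg A a) = neg B (φ a) :=
  (h GiraleOp.neg ![a]).trans (congrArg (B.op GiraleOp.neg) (FinVec.map_eq φ ![a]).symm)

theorem IsHom.map_bang (a : A.carrier) : φ (bang A a) = bang B (φ a) :=
  (h GiraleOp.bang ![a]).trans (congrArg (B.op GiraleOp.bang) (FinVec.map_eq φ ![a]).symm)

theorem IsHom.map_one : φ (one A) = one B :=
  (h GiraleOp.one ![]).trans (congrArg (B.op GiraleOp.one) (FinVec.map_eq φ ![]).symm)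

theorem IsHom.map_zero : φ (zero A) = zero B :=
  (h.map_neg _).trans (congrArg (neg B) h.map_one)

end GiraleHom

section HeytHom

variable {A B : UAlg.{u} heytType} {φ : A.carrier → B.carrier} (h : IsHom A B φ)
include h

theorem IsHom.map_hjoin (a b : A.carrier) : φ (hjoin A a b) = hjoin B (φ a) (φ b) :=
  (h HeytOp.join ![a, b]).trans (congrArg (B.op HeytOp.join) (FinVec.map_eq φ ![a, b]).symm)

theorem IsHom.map_hmeet (a b : A.carrier) : φ (hmeet A a b) = hmeet B (φ a) (φ b) :=
  (h HeytOp.meet ![a, b]).trans (congrArg (B.op HeytOp.meet) (FinVec.map_eq φ ![a, b]).symm)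

theorem IsHom.map_himp (a b : A.carrier) : φ (himp A a b) = himp B (φ a) (φ b) :=
  (h HeytOp.imp ![a, b]).trans (congrArg (B.op HeytOp.imp) (FinVec.map_eq φ ![a, b]).symm)

theorem IsHom.map_hbot : φ (hbot A) = hbot B :=
  (h HeytOp.bot ![]).trans (congrArg (B.op HeytOp.bot) (FinVec.map_eq φ ![]).symm)

theorem IsHom.map_hone : φ (hone A) = hone B :=
  (h HeytOp.one ![]).trans (congrArg (B.op HeytOp.one) (FinVec.map_eq φ ![]).symm)

end HeytHom

theorem le_iff_of_mem_ISP {A C : UAlg.{u} giraleType} (hA : A ∈ ISP C) {x y : A.carrier} :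
    le A x y ↔ ∀ φ, IsHom A C φ → le C (φ x) (φ y) where
  mp hxy φ h := (h.map_meet x y).symm.trans (congrArg φ hxy)
  mpr hall := hA _ _ fun φ h => (h.map_meet x y).trans (hall φ h)

theorem IsGirale.of_mem_ISP {A C : UAlg.{u} giraleType} (hC : IsGirale C) (hA : A ∈ ISP C) :
    IsGirale A where
  join_comm _ _ := hA _ _ fun _ h => by simpa only [h.map_join] using hC.join_comm _ _
  join_assoc _ _ _ := hA _ _ fun _ h => by simpa only [h.map_join] using hC.join_assoc _ _ _
  meet_comm _ _ := hA _ _ fun _ h => by simpa only [h.map_meet] using hC.meet_comm _ _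
  meet_assoc _ _ _ := hA _ _ fun _ h => by simpa only [h.map_meet] using hC.meet_assoc _ _ _
  join_meet_self _ _ := hA _ _ fun _ h => by
    simpa only [h.map_join, h.map_meet] using hC.join_meet_self _ _
  meet_join_self _ _ := hA _ _ fun _ h => by
    simpa only [h.map_join, h.map_meet] using hC.meet_join_self _ _
  mul_comm _ _ := hA _ _ fun _ h => by simpa only [h.map_mul] using hC.mul_comm _ _
  mul_assoc _ _ _ := hA _ _ fun _ h => by simpa only [h.map_mul] using hC.mul_assoc _ _ _
  one_mul _ := hA _ _ fun _ h => by simpa only [h.map_mul, h.map_one] using hC.one_mul _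
  residuation a b c := by
    rw [le_iff_of_mem_ISP hA, le_iff_of_mem_ISP hA]
    exact forall₂_congr fun φ h => by simpa only [h.map_mul, h.map_imp] using hC.residuation _ _ _
  involutive _ := hA _ _ fun _ h => by
    simpa only [h.map_imp, h.map_zero] using hC.involutive _
  neg_eq _ := hA _ _ fun _ h => by
    simpa only [h.map_neg, h.map_imp, h.map_zero] using hC.neg_eq _
  bang_one := hA _ _ fun _ h => by simpa only [h.map_bang, h.map_one] using hC.bang_one
  bang_le a := (le_iff_of_mem_ISP hA).2 fun _ h => by
    simpa only [h.map_bang, h.map_meet, h.map_one] using hC.bang_le _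
  bang_mul_bang _ _ := hA _ _ fun _ h => by
    simpa only [h.map_bang, h.map_mul, h.map_meet] using hC.bang_mul_bang _ _
  bang_bang _ := hA _ _ fun _ h => by simpa only [h.map_bang] using hC.bang_bang _

theorem hle_iff_of_mem_ISP {A C : UAlg.{u} heytType} (hA : A ∈ ISP C) {x y : A.carrier} :
    hle A x y ↔ ∀ φ, IsHom A C φ → hle C (φ x) (φ y) where
  mp hxy φ h := (h.map_hmeet x y).symm.trans (congrArg φ hxy)
  mpr hall := hA _ _ fun φ h => (h.map_hmeet x y).trans (hall φ h)

theorem IsHeyting.of_mem_ISP {A C : UAlg.{u} heytType} (hC : IsHeyting C) (hA : A ∈ ISP C) :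
    IsHeyting A where
  join_comm _ _ := hA _ _ fun _ h => by simpa only [h.map_hjoin] using hC.join_comm _ _
  join_assoc _ _ _ := hA _ _ fun _ h => by simpa only [h.map_hjoin] using hC.join_assoc _ _ _
  meet_comm _ _ := hA _ _ fun _ h => by simpa only [h.map_hmeet] using hC.meet_comm _ _
  meet_assoc _ _ _ := hA _ _ fun _ h => by simpa only [h.map_hmeet] using hC.meet_assoc _ _ _
  join_meet_self _ _ := hA _ _ fun _ h => by
    simpa only [h.map_hjoin, h.map_hmeet] using hC.join_meet_self _ _
  meet_join_self _ _ := hA _ _ fun _ h => by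
    simpa only [h.map_hjoin, h.map_hmeet] using hC.meet_join_self _ _
  bot_le _ := (hle_iff_of_mem_ISP hA).2 fun _ h => by
    simpa only [h.map_hbot] using hC.bot_le _
  le_one _ := (hle_iff_of_mem_ISP hA).2 fun _ h => by
    simpa only [h.map_hone] using hC.le_one _
  residuation a b c := by
    rw [hle_iff_of_mem_ISP hA, hle_iff_of_mem_ISP hA]
    exact forall₂_congr fun φ h => by
      simpa only [h.map_hmeet, h.map_himp] using hC.residuation _ _ _

theorem IsBooleanAlg.of_mem_ISP {A C : UAlg.{u} heytType} (hC : IsBooleanAlg C)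
    (hA : A ∈ ISP C) : IsBooleanAlg A :=
  ⟨hC.1.of_mem_ISP hA, fun _ => hA _ _ fun _ h => by
    simpa only [h.map_hjoin, h.map_himp, h.map_hbot, h.map_hone] using hC.2 _⟩

theorem isHom_bangAlg {A B : UAlg.{u} giraleType} (hA : IsGirale A) (hB : IsGirale B)
    {φ : A.carrier → B.carrier} (h : IsHom A B φ) :
    IsHom (bangAlg A hA) (bangAlg B hB)
      (Subtype.map φ fun _ ⟨b, hb⟩ => ⟨φ b, hb ▸ (h.map_bang b).symm⟩) := by
  intro f x
  cases f
  · exact Subtype.ext (h.map_join _ _)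
  · exact Subtype.ext ((h.map_bang _).trans (congrArg _ (h.map_meet _ _)))
  · exact Subtype.ext ((h.map_bang _).trans (congrArg _ (h.map_imp _ _)))
  · exact Subtype.ext ((h.map_bang _).trans (congrArg _ h.map_zero))
  · exact Subtype.ext h.map_one

theorem bangAlg_mem_ISP {A C : UAlg.{u} giraleType} (hA : IsGirale A) (hC : IsGirale C)
    (h : A ∈ ISP C) : bangAlg A hA ∈ ISP (bangAlg C hC) := fun x y hxy =>
  Subtype.ext (h x.1 y.1 fun _ hφ => congrArg Subtype.val (hxy _ (isHom_bangAlg hA hC hφ)))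

theorem IsBooleanGirale.of_mem_ISP {A C : UAlg.{u} giraleType} (hC : IsBooleanGirale C)
    (hA : A ∈ ISP C) : IsBooleanGirale A :=
  let ⟨girale, boolean⟩ := hC
  ⟨girale.of_mem_ISP hA, boolean.of_mem_ISP (bangAlg_mem_ISP _ girale hA)⟩

/-! ## Order and equality in girales -/

namespace IsGirale

variable {A : UAlg.{u} giraleType} (hA : IsGirale A)
include hA

/-- The lattice reduct of a girale, as a Mathlib lattice. -/
abbrev lattice : Lattice A.carrier :=
  let _ : Max A.carrier := ⟨join A⟩
  let _ : Min A.carrier := ⟨meet A⟩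
  Lattice.mk' hA.join_comm hA.join_assoc hA.meet_comm hA.meet_assoc hA.join_meet_self
    hA.meet_join_self

theorem le_iff {x y : A.carrier} : le A x y ↔ let _ := hA.lattice; x ≤ y :=
  let _ := hA.lattice
  inf_eq_left

theorem one_le_imp_iff {x y : A.carrier} : le A (one A) (imp A x y) ↔ le A x y := by
  rw [← hA.residuation, hA.one_mul]

theorem bang_le_self (x : A.carrier) : le A (bang A x) x :=
  let _ := hA.lattice
  hA.le_iff.2 ((hA.le_iff.1 (hA.bang_le x)).trans inf_le_left)

theorem bang_eq_one_iff {x : A.carrier} : bang A x = one A ↔ le A (one A) x := by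
  refine ⟨fun h => h ▸ hA.bang_le_self x, fun h => ?_⟩
  calc bang A x = mul A (bang A (one A)) (bang A x) := by rw [hA.bang_one, hA.one_mul]
    _ = one A := by rw [hA.bang_mul_bang, h, hA.bang_one]

end IsGirale

/-- The element `!((x → y) ∧ (y → x))` of a girale, an equality test inside the language of
girales: it is `1` precisely if `x = y`. -/
def bangEquiv (A : UAlg.{u} giraleType) (x y : A.carrier) : A.carrier :=
  bang A (meet A (imp A x y) (imp A y x))

theorem IsHom.map_bangEquiv {A B : UAlg.{u} giraleType} {φ : A.carrier → B.carrier}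
    (h : IsHom A B φ) (x y : A.carrier) : φ (bangEquiv A x y) = bangEquiv B (φ x) (φ y) := by
  simp only [bangEquiv, h.map_bang, h.map_meet, h.map_imp]

theorem IsGirale.bangEquiv_eq_one_iff {A : UAlg.{u} giraleType} (hA : IsGirale A)
    {x y : A.carrier} : bangEquiv A x y = one A ↔ x = y := by
  let _ := hA.lattice
  calc bangEquiv A x y = one A ↔ le A (one A) (imp A x y) ∧ le A (one A) (imp A y x) := by
        rw [bangEquiv, hA.bang_eq_one_iff, hA.le_iff, hA.le_iff, hA.le_iff]
        exact le_inf_iff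
    _ ↔ x ≤ y ∧ y ≤ x := by
        rw [hA.one_le_imp_iff, hA.one_le_imp_iff, hA.le_iff, hA.le_iff]
    _ ↔ x = y := le_antisymm_iff.symm

/-! ## Girales in which `!` takes two values -/

/-- A girale is two-valued if `1` and `!0` are distinct and are the only values of `!`. -/
structure IsTwoValued (A : UAlg.{u} giraleType) : Prop where
  girale : IsGirale A
  bang_zero_ne_one : bang A (zero A) ≠ one A
  bang_eq : ∀ x, bang A x = one A ∨ bang A x = bang A (zero A)

open Classical in
/-- The value `1` or `!0` of `!` that stands for the truth value of `P`. -/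
noncomputable def truthValue (A : UAlg.{u} giraleType) (P : Prop) : A.carrier :=
  if P then one A else bang A (zero A)

theorem truthValue_of {A : UAlg.{u} giraleType} {P : Prop} (h : P) : truthValue A P = one A :=
  if_pos h

theorem truthValue_of_not {A : UAlg.{u} giraleType} {P : Prop} (h : ¬P) :
    truthValue A P = bang A (zero A) := if_neg h

namespace IsTwoValued

variable {A B C : UAlg.{u} giraleType}

section TruthValues

variable (hA : IsTwoValued A)
include hA

theorem nontrivial : Nontrivial A.carrier := ⟨_, _, hA.bang_zero_ne_one⟩

theorem truthValue_eq_one_iff {P : Prop} : truthValue A P = one A ↔ P :=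
  ⟨fun h => by_contra fun hP => hA.bang_zero_ne_one (truthValue_of_not hP ▸ h), truthValue_of⟩

theorem truthValue_eq_bang_zero_iff {P : Prop} : truthValue A P = bang A (zero A) ↔ ¬P :=
  ⟨fun h hP => hA.bang_zero_ne_one (h.symm.trans (truthValue_of hP)), truthValue_of_not⟩

theorem truthValue_injective : Function.Injective (truthValue A) := fun _ _ h =>
  propext (hA.truthValue_eq_one_iff.symm.trans (h ▸ hA.truthValue_eq_one_iff))

theorem bang_eq_truthValue (x : A.carrier) : bang A x = truthValue A (le A (one A) x) := by
  by_cases h : le A (one A) x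
  · rw [truthValue_of h, hA.girale.bang_eq_one_iff.2 h]
  · rw [truthValue_of_not h,
      (hA.bang_eq x).resolve_left fun h' => h (hA.girale.bang_eq_one_iff.1 h')]

theorem bangEquiv_eq_truthValue (x y : A.carrier) : bangEquiv A x y = truthValue A (x = y) := by
  rw [bangEquiv, hA.bang_eq_truthValue, ← hA.girale.bang_eq_one_iff, ← bangEquiv,
    hA.girale.bangEquiv_eq_one_iff]

theorem bang_truthValue (P : Prop) : bang A (truthValue A P) = truthValue A P := by
  by_cases hP : P
  · rw [truthValue_of hP, hA.girale.bang_one]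
  · rw [truthValue_of_not hP, hA.girale.bang_bang]

-- If `!(0 ∧ x)` were `1`, then so would be `!0`; hence `!0 = !(0 ∧ x) ≤ x`.
theorem bang_zero_le (x : A.carrier) : le A (bang A (zero A)) x := by
  let _ := hA.girale.lattice
  have bang_meet_ne_one : bang A (meet A (zero A) x) ≠ one A := fun h =>
    hA.bang_zero_ne_one (hA.girale.bang_eq_one_iff.2 (hA.girale.le_iff.2
      ((hA.girale.le_iff.1 (hA.girale.bang_eq_one_iff.1 h)).trans inf_le_left)))
  have bang_le := hA.girale.le_iff.1 (hA.girale.bang_le_self (meet A (zero A) x))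
  rw [(hA.bang_eq _).resolve_left bang_meet_ne_one] at bang_le
  exact hA.girale.le_iff.2 (bang_le.trans inf_le_right)

theorem bang_zero_mul (x : A.carrier) : mul A (bang A (zero A)) x = bang A (zero A) := by
  let _ := hA.girale.lattice
  apply le_antisymm <;> rw [← hA.girale.le_iff]
  · exact (hA.girale.residuation _ _ _).2 (hA.bang_zero_le _)
  · exact hA.bang_zero_le _

theorem mul_truthValue (P Q : Prop) :
    mul A (truthValue A P) (truthValue A Q) = truthValue A (P ∧ Q) := by
  by_cases hP : P
  · rw [truthValue_of hP, hA.girale.one_mul, and_iff_right hP]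
  · rw [truthValue_of_not hP, hA.bang_zero_mul, truthValue_of_not fun h => hP h.1]

theorem truthValue_le_truthValue_iff {P Q : Prop} :
    le A (truthValue A P) (truthValue A Q) ↔ (P → Q) := by
  by_cases hP : P
  · rw [truthValue_of hP, ← hA.girale.bang_eq_one_iff, hA.bang_truthValue,
      hA.truthValue_eq_one_iff, forall_prop_of_true hP]
  · rw [truthValue_of_not hP]
    exact iff_of_true (hA.bang_zero_le _) fun h => absurd h hP

theorem join_truthValue (P Q : Prop) :
    join A (truthValue A P) (truthValue A Q) = truthValue A (P ∨ Q) := by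
  let _ := hA.girale.lattice
  by_cases hPQ : P → Q
  · rw [or_iff_right_of_imp hPQ]
    exact sup_eq_right.2 (hA.girale.le_iff.1 (hA.truthValue_le_truthValue_iff.2 hPQ))
  · have hQ := (Classical.not_imp.1 hPQ).2
    rw [or_iff_left hQ]
    exact sup_eq_left.2 (hA.girale.le_iff.1 (hA.truthValue_le_truthValue_iff.2 hQ.elim))

theorem bang_meet_truthValue (P Q : Prop) :
    bang A (meet A (truthValue A P) (truthValue A Q)) = truthValue A (P ∧ Q) := by
  rw [← hA.girale.bang_mul_bang, hA.bang_truthValue, hA.bang_truthValue, hA.mul_truthValue]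

theorem bang_imp_truthValue (P Q : Prop) :
    bang A (imp A (truthValue A P) (truthValue A Q)) = truthValue A (P → Q) := by
  rw [hA.bang_eq_truthValue, hA.girale.one_le_imp_iff, hA.truthValue_le_truthValue_iff]

end TruthValues

theorem of_injective (hC : IsTwoValued C) {φ : A.carrier → C.carrier} (hφ : IsHom A C φ)
    (inj : Function.Injective φ) : IsTwoValued A where
  girale := hC.girale.of_mem_ISP (mem_ISP_of_injective (mem_ISP_self C) hφ inj)
  bang_zero_ne_one h := hC.bang_zero_ne_one <| by
    rw [← hφ.map_zero, ← hφ.map_bang, h, hφ.map_one]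
  bang_eq x := (hC.bang_eq (φ x)).imp
    (fun h => inj (by rw [hφ.map_bang, h, hφ.map_one]))
    (fun h => inj (by rw [hφ.map_bang, h, hφ.map_bang, hφ.map_zero]))

-- If `φ x = φ y` and `x ≠ y`, then `φ` identifies the equality tests `1` and `!0`, hence also
-- `1 · z = z` and `!0 · z = !0` for all `z`.
theorem injective_or_constant (hA : IsTwoValued A) {φ : A.carrier → B.carrier}
    (hφ : IsHom A B φ) : Function.Injective φ ∨ ∀ x y, φ x = φ y := by
  refine or_iff_not_imp_left.2 fun hinj => ?_
  obtain ⟨x, y, hxy, hne⟩ := Function.not_injective_iff.1 hinj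
  have map_one_eq : φ (one A) = φ (bang A (zero A)) :=
    calc φ (one A) = φ (bangEquiv A x x) := by rw [hA.girale.bangEquiv_eq_one_iff.2 rfl]
      _ = φ (bangEquiv A x y) := by rw [hφ.map_bangEquiv, hφ.map_bangEquiv, hxy]
      _ = φ (bang A (zero A)) := by rw [hA.bangEquiv_eq_truthValue, truthValue_of_not hne]
  have map_eq : ∀ z, φ z = φ (bang A (zero A)) := fun z => by
    rw [← hA.bang_zero_mul z, hφ.map_mul, ← map_one_eq, ← hφ.map_mul, hA.girale.one_mul]
  exact fun z w => (map_eq z).trans (map_eq w).symm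

theorem isSimpleAlg (hA : IsTwoValued A) : IsSimpleAlg A :=
  have := hA.nontrivial
  isSimpleAlg_of_forall_isHom fun _ _ => hA.injective_or_constant

theorem exists_forall_isHom_eq_truthValue (hC : IsTwoValued C) {φ : A.carrier → B.carrier}
    (hφ : IsHom A B φ) (hA : IsGirale A) (s : Finset (A.carrier × A.carrier))
    (hs : ∀ p ∈ s, φ p.1 = φ p.2) :
    ∃ e, φ e = φ (one A) ∧
      ∀ ψ, IsHom A C ψ → ψ e = truthValue C (∀ p ∈ s, ψ p.1 = ψ p.2) := by
  classical
  induction s using Finset.induction_on with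
  | empty => exact ⟨one A, rfl, fun ψ hψ => by rw [hψ.map_one, truthValue_of (by simp)]⟩
  | insert p s _ ih =>
    simp only [Finset.forall_mem_insert] at hs ⊢
    obtain ⟨e, he, hψe⟩ := ih hs.2
    refine ⟨mul A (bangEquiv A p.1 p.2) e, ?_, fun ψ hψ => ?_⟩
    · rw [hφ.map_mul, hφ.map_bangEquiv, hs.1, ← hφ.map_bangEquiv, he,
        hA.bangEquiv_eq_one_iff.2 rfl, ← hφ.map_mul, hA.one_mul]
    · rw [hψ.map_mul, hψ.map_bangEquiv, hψe ψ hψ, hC.bangEquiv_eq_truthValue, hC.mul_truthValue]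

-- If no homomorphism into `C` that identifies the pairs in `s` separated `x` from `y`, then the
-- equality test `e` for `s` would give `e · x = e · y` in `A`, and `φ e = 1`.
theorem mem_ISP_of_surjective (hC : IsTwoValued C) [Finite C.carrier] (hA : A ∈ ISP C)
    {φ : A.carrier → B.carrier} (hφ : IsHom A B φ) (surj : Function.Surjective φ) :
    B ∈ ISP C := by
  have girale := hC.girale.of_mem_ISP hA
  refine Girales.mem_ISP_of_surjective hφ surj fun s hs x y hxy => ?_
  by_contra! hall
  obtain ⟨e, he, hψe⟩ := hC.exists_forall_isHom_eq_truthValue hφ girale s hs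
  have mul_eq : mul A e x = mul A e y := hA _ _ fun ψ hψ => by
    rw [hψ.map_mul, hψ.map_mul, hψe ψ hψ]
    by_cases h : ∀ p ∈ s, ψ p.1 = ψ p.2
    · rw [hall ψ hψ h]
    · rw [truthValue_of_not h, hC.bang_zero_mul, hC.bang_zero_mul]
  have map_mul_eq : ∀ z, φ (mul A e z) = φ z := fun z => by
    rw [hφ.map_mul, he, ← hφ.map_mul, girale.one_mul]
  exact hxy (by rw [← map_mul_eq x, mul_eq, map_mul_eq])

section GeneratedVariety

variable (hC : IsTwoValued C) [Finite C.carrier]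
include hC

theorem V_eq_ISP : V C = ISP C :=
  (V_subset (isVariety_ISP fun _ _ _ hA => hC.mem_ISP_of_surjective hA) (mem_ISP_self C)).antisymm
    (ISP_subset_V C)

theorem isGiraleVariety_V : IsGiraleVariety (V C) :=
  ⟨isVariety_V C, fun _ hA => hC.girale.of_mem_ISP (hC.V_eq_ISP ▸ hA)⟩

theorem mem_V_and_isSubdirectlyIrreducible_iff :
    A ∈ V C ∧ IsSubdirectlyIrreducible A ↔ ∃ φ, IsHom A C φ ∧ Function.Injective φ where
  mp hA := hA.2.exists_embedding (hC.V_eq_ISP ▸ hA.1)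
  mpr h :=
    let ⟨_, hφ, inj⟩ := h
    ⟨(isVariety_V C).closed_S C (mem_V_self C) A h,
      (hC.of_injective hφ inj).isSimpleAlg.isSubdirectlyIrreducible⟩

end GeneratedVariety

end IsTwoValued

/-! ## Boolean algebras -/

/-- The two-element Boolean algebra of truth values. -/
def propAlg : UAlg.{u} heytType where
  carrier := ULift.{u} Prop
  op f := match f with
    | .join => fun x : Fin 2 → ULift.{u} Prop => ⟨(x 0).down ∨ (x 1).down⟩
    | .meet => fun x : Fin 2 → ULift.{u} Prop => ⟨(x 0).down ∧ (x 1).down⟩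
    | .imp => fun x : Fin 2 → ULift.{u} Prop => ⟨(x 0).down → (x 1).down⟩
    | .bot => fun _ => ⟨False⟩
    | .one => fun _ => ⟨True⟩

theorem propAlg_ext {p q : propAlg.{u}.carrier} (h : p.down ↔ q.down) : p = q :=
  ULift.ext p q (propext h)

theorem hle_propAlg_iff {p q : propAlg.{u}.carrier} : hle propAlg p q ↔ (p.down → q.down) :=
  ULift.ext_iff.trans (eq_iff_iff.trans and_iff_left_iff_imp)

theorem isBooleanAlg_propAlg : IsBooleanAlg propAlg.{u} where
  left :=
    { join_comm := fun _ _ => propAlg_ext or_comm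
      join_assoc := fun _ _ _ => propAlg_ext or_assoc
      meet_comm := fun _ _ => propAlg_ext and_comm
      meet_assoc := fun _ _ _ => propAlg_ext and_assoc
      join_meet_self := fun _ _ => propAlg_ext (or_iff_left_of_imp And.left)
      meet_join_self := fun _ _ => propAlg_ext (and_iff_left_of_imp Or.inl)
      bot_le := fun _ => hle_propAlg_iff.2 False.elim
      le_one := fun _ => hle_propAlg_iff.2 fun _ => trivial
      residuation := fun _ _ _ => by
        rw [hle_propAlg_iff, hle_propAlg_iff]
        exact and_imp }
  right p := propAlg_ext (iff_true_intro (Classical.em p.down))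

/-- A Heyting algebra in the sense of `IsHeyting`, as a Mathlib Heyting algebra. -/
abbrev IsHeyting.heytingAlgebra {B : UAlg.{u} heytType} (hB : IsHeyting B) :
    HeytingAlgebra B.carrier :=
  let _ : Max B.carrier := ⟨hjoin B⟩
  let _ : Min B.carrier := ⟨hmeet B⟩
  let L : Lattice B.carrier := Lattice.mk' hB.join_comm hB.join_assoc hB.meet_comm hB.meet_assoc
    hB.join_meet_self hB.meet_join_self
  have le_iff {a b : B.carrier} : a ≤ b ↔ hle B a b := inf_eq_left.symm
  { L with
    top := hone B
    le_top := fun a => le_iff.2 (hB.le_one a)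
    himp := himp B
    le_himp_iff := fun a b c => by rw [le_iff, le_iff]; exact (hB.residuation a b c).symm
    bot := hbot B
    bot_le := fun a => le_iff.2 (hB.bot_le a)
    compl := fun a => himp B a (hbot B)
    himp_bot := fun _ => rfl }

/-- A Boolean algebra in the sense of `IsBooleanAlg`, as a Mathlib Boolean algebra. -/
abbrev IsBooleanAlg.booleanAlgebra {B : UAlg.{u} heytType} (hB : IsBooleanAlg B) :
    BooleanAlgebra B.carrier :=
  let _ := hB.1.heytingAlgebra
  .ofRegular fun a => by
    rw [show a ⊔ aᶜ = ⊤ from hB.2 a]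
    exact Heyting.isRegular_top

section HomOfHeyting

variable {A B : UAlg.{u} heytType} {φ : A.carrier → B.carrier}

theorem IsHom.map_hle (h : IsHom A B φ) {a b : A.carrier} (hab : hle A a b) :
    hle B (φ a) (φ b) :=
  (h.map_hmeet a b).symm.trans (congrArg φ hab)

theorem IsHom.hle_himp_iff (h : IsHom A B φ) (hA : IsHeyting A) (a b c : A.carrier) :
    hle B (hmeet B (φ a) (φ b)) (φ c) ↔ hle B (φ a) (himp B (φ b) (φ c)) := by
  let _ := hA.heytingAlgebra
  have map_le {a b : A.carrier} (hab : a ≤ b) : hle B (φ a) (φ b) :=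
    h.map_hle (inf_eq_left.2 hab)
  constructor <;> intro hab
  · have map_inf_inf : φ (a ⊓ b ⊓ c) = φ (a ⊓ b) :=
      (h.map_hmeet _ _).trans ((h.map_hmeet a b).symm ▸ hab)
    have map_sup : φ (a ⊓ b ⊔ c) = φ c :=
      calc φ (a ⊓ b ⊔ c) = φ (a ⊓ b ⊓ c ⊔ c) :=
            (h.map_hjoin _ _).trans (map_inf_inf ▸ (h.map_hjoin _ _).symm)
        _ = φ c := congrArg φ (sup_eq_right.2 inf_le_right)
    rw [← map_sup, ← h.map_himp]
    exact map_le (le_himp_iff.2 le_sup_left)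
  · have map_inf : φ (a ⊓ (b ⇨ c)) = φ a := (h.map_hmeet _ _).trans (h.map_himp b c ▸ hab)
    rw [← map_inf, ← h.map_hmeet]
    exact map_le (le_himp_iff.1 inf_le_right)

theorem IsHeyting.of_surjective (hA : IsHeyting A) (h : IsHom A B φ)
    (surj : Function.Surjective φ) : IsHeyting B where
  join_comm := surj.forall₂.2 fun a b => by
    simpa only [h.map_hjoin] using congrArg φ (hA.join_comm a b)
  join_assoc := surj.forall₃.2 fun a b c => by
    simpa only [h.map_hjoin] using congrArg φ (hA.join_assoc a b c)
  meet_comm := surj.forall₂.2 fun a b => by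
    simpa only [h.map_hmeet] using congrArg φ (hA.meet_comm a b)
  meet_assoc := surj.forall₃.2 fun a b c => by
    simpa only [h.map_hmeet] using congrArg φ (hA.meet_assoc a b c)
  join_meet_self := surj.forall₂.2 fun a b => by
    simpa only [h.map_hjoin, h.map_hmeet] using congrArg φ (hA.join_meet_self a b)
  meet_join_self := surj.forall₂.2 fun a b => by
    simpa only [h.map_hjoin, h.map_hmeet] using congrArg φ (hA.meet_join_self a b)
  bot_le := surj.forall.2 fun a => h.map_hbot ▸ h.map_hle (hA.bot_le a)
  le_one := surj.forall.2 fun a => h.map_hone ▸ h.map_hle (hA.le_one a)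
  residuation := surj.forall₃.2 fun a b c => h.hle_himp_iff hA a b c

theorem IsBooleanAlg.of_surjective (hA : IsBooleanAlg A) (h : IsHom A B φ)
    (surj : Function.Surjective φ) : IsBooleanAlg B :=
  ⟨hA.1.of_surjective h surj, surj.forall.2 fun a => by
    rw [← h.map_hbot, ← h.map_himp, ← h.map_hjoin, hA.2, h.map_hone]⟩

theorem IsHom.of_map_heytOps
    (hjoin : ∀ a b, φ (hjoin A a b) = hjoin B (φ a) (φ b))
    (hmeet : ∀ a b, φ (hmeet A a b) = hmeet B (φ a) (φ b))
    (himp : ∀ a b, φ (himp A a b) = himp B (φ a) (φ b))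
    (hbot : φ (hbot A) = hbot B) (hone : φ (hone A) = hone B) : IsHom A B φ := by
  intro f x
  rw [← FinVec.etaExpand_eq x, ← FinVec.etaExpand_eq fun i => φ _]
  cases f
  · exact hjoin _ _
  · exact hmeet _ _
  · exact himp _ _
  · exact hbot
  · exact hone

end HomOfHeyting

theorem IsBooleanAlg.isHom_notMem_prime {B : UAlg.{u} heytType} (hB : IsBooleanAlg B) :
    let _ := hB.booleanAlgebra
    ∀ J : Order.Ideal B.carrier, J.IsPrime → IsHom B propAlg fun b => ⟨b ∉ J⟩ := by
  intro _ J hJ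
  have inf_mem_iff {a b : B.carrier} : a ⊓ b ∈ J ↔ a ∈ J ∨ b ∈ J :=
    ⟨hJ.mem_or_mem, fun h => h.elim (J.lower inf_le_left) (J.lower inf_le_right)⟩
  have compl_mem_iff {a : B.carrier} : aᶜ ∈ J ↔ a ∉ J :=
    ⟨fun hc ha => hJ.top_notMem (sup_compl_eq_top (x := a) ▸ Order.Ideal.sup_mem ha hc),
      hJ.compl_mem_of_notMem⟩
  refine .of_map_heytOps (fun a b => propAlg_ext ?_) (fun a b => propAlg_ext ?_)
    (fun a b => propAlg_ext ?_) (propAlg_ext ?_) (propAlg_ext ?_)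
  · change a ⊔ b ∉ J ↔ a ∉ J ∨ b ∉ J
    rw [Order.Ideal.sup_mem_iff, not_and_or]
  · change a ⊓ b ∉ J ↔ a ∉ J ∧ b ∉ J
    rw [inf_mem_iff, not_or]
  · change a ⇨ b ∉ J ↔ (a ∉ J → b ∉ J)
    rw [himp_eq, Order.Ideal.sup_mem_iff, compl_mem_iff]
    tauto
  · exact iff_false_intro (not_not.2 J.bot_mem)
  · exact iff_true_intro hJ.top_notMem

theorem IsBooleanAlg.mem_ISP_propAlg {B : UAlg.{u} heytType} (hB : IsBooleanAlg B) :
    B ∈ ISP propAlg := by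
  let _ := hB.booleanAlgebra
  have le_of_forall {x y : B.carrier} (hxy : ∀ φ, IsHom B propAlg φ → φ x = φ y) : x ≤ y := by
    by_contra hle
    have disj : Disjoint (Order.PFilter.principal x : Set B.carrier) (Order.Ideal.principal y) :=
      Set.disjoint_left.2 fun z hxz hzy => hle <|
        (Order.PFilter.mem_principal.1 hxz).trans (Order.Ideal.mem_principal.1 hzy)
    obtain ⟨J, hJ, hyJ, hxJ⟩ := DistribLattice.prime_ideal_of_disjoint_filter_ideal disj
    have hx : x ∉ J := Set.disjoint_left.1 hxJ (Order.PFilter.mem_principal.2 le_rfl)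
    have hy : y ∈ J := hyJ (Order.Ideal.mem_principal.2 le_rfl)
    exact (congrArg ULift.down (hxy _ (hB.isHom_notMem_prime J hJ))).mp hx hy
  exact fun x y hxy => (le_of_forall hxy).antisymm (le_of_forall fun φ hφ => (hxy φ hφ).symm)

theorem booleanAlgs_eq_ISP_propAlg : BooleanAlgs.{u} = ISP propAlg :=
  Set.Subset.antisymm (fun _ hB => IsBooleanAlg.mem_ISP_propAlg hB)
    fun _ hB => isBooleanAlg_propAlg.of_mem_ISP hB

theorem isVariety_booleanAlgs : IsVariety BooleanAlgs.{u} := by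
  rw [booleanAlgs_eq_ISP_propAlg]
  exact isVariety_ISP fun A B φ hA hφ surj =>
    ((isBooleanAlg_propAlg.of_mem_ISP hA).of_surjective hφ surj).mem_ISP_propAlg

theorem booleanAlgs_ne_trivialClass : BooleanAlgs.{u} ≠ trivialClass heytType := fun h =>
  have : Subsingleton (ULift.{u} Prop) := (h ▸ isBooleanAlg_propAlg : propAlg ∈ trivialClass _)
  not_subsingleton _ this

/-! ## Boolean powers -/

theorem IsTwoValued.isHom_truthValue {A : UAlg.{u} giraleType} (hA : IsTwoValued A) :
    IsHom propAlg (bangAlg A hA.girale)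
      fun p => ⟨truthValue A p.down, _, hA.bang_truthValue p.down⟩ := by
  refine .of_map_heytOps (fun p q => Subtype.ext ?_) (fun p q => Subtype.ext ?_)
    (fun p q => Subtype.ext ?_) (Subtype.ext ?_) (Subtype.ext ?_)
  · exact (hA.join_truthValue _ _).symm
  · exact (hA.bang_meet_truthValue _ _).symm
  · exact (hA.bang_imp_truthValue _ _).symm
  · exact truthValue_of_not not_false
  · exact truthValue_of trivial

theorem IsTwoValued.isBooleanGirale {A : UAlg.{u} giraleType} (hA : IsTwoValued A) :
    IsBooleanGirale A :=
  ⟨hA.girale, isBooleanAlg_propAlg.of_surjective hA.isHom_truthValue fun ⟨_, x, hx⟩ =>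
    ⟨⟨le A (one A) x⟩, Subtype.ext ((hA.bang_eq_truthValue x).symm.trans hx)⟩⟩

theorem IsTwoValued.isBooleanGirale_of_mem_V {A C : UAlg.{u} giraleType} (hC : IsTwoValued C)
    [Finite C.carrier] (hA : A ∈ V C) : IsBooleanGirale A :=
  hC.isBooleanGirale.of_mem_ISP (hC.V_eq_ISP ▸ hA)

/-- The underlying set of the Stone space of a Boolean algebra `B`: the homomorphisms from `B` to
the two-element Boolean algebra. -/
def DualSpace (B : UAlg.{u} heytType) : Type u := {e : B.carrier → propAlg.{u}.carrier //
  IsHom B propAlg e}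

/-- The field of sets that represents a Boolean algebra `B` in its Stone space. It stands in for
the topology of the space, whose clopen sets are exactly these. -/
def representable (B : UAlg.{u} heytType) : BooleanSubalgebra (Set (DualSpace B)) where
  carrier := Set.range fun b => {e | (e.1 b).down}
  supClosed' := by
    rintro _ ⟨a, rfl⟩ _ ⟨b, rfl⟩
    exact ⟨hjoin B a b, Set.ext fun e => iff_of_eq (congrArg ULift.down (e.2.map_hjoin a b))⟩
  infClosed' := by
    rintro _ ⟨a, rfl⟩ _ ⟨b, rfl⟩
    exact ⟨hmeet B a b, Set.ext fun e => iff_of_eq (congrArg ULift.down (e.2.map_hmeet a b))⟩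
  bot_mem' := ⟨hbot B, Set.ext fun e => iff_of_eq (congrArg ULift.down e.2.map_hbot)⟩
  compl_mem' := by
    rintro _ ⟨a, rfl⟩
    refine ⟨himp B a (hbot B), Set.ext fun e => ?_⟩
    have map_eq : e.1 (himp B a (hbot B)) = himp propAlg (e.1 a) (hbot propAlg) :=
      (e.2.map_himp _ _).trans (by rw [e.2.map_hbot])
    exact iff_of_eq (congrArg ULift.down map_eq)

theorem mem_representable {B : UAlg.{u} heytType} {s : Set (DualSpace B)} :
    s ∈ representable B ↔ ∃ b, {e | (e.1 b).down} = s := Iff.rfl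

/-- The Boolean power of a finite algebra `C` by a Boolean algebra `B`: the continuous functions
from the Stone space of `B` to the discrete space `C`, with pointwise operations. -/
def booleanPower {σ : AlgType} (C : UAlg.{u} σ) [Finite C.carrier] (B : UAlg.{u} heytType) :
    UAlg.{u} σ where
  carrier := {f : DualSpace B → C.carrier // ∀ c, f ⁻¹' {c} ∈ representable B}
  op s x := ⟨fun e => C.op s fun j => (x j).1 e, fun c => by
    have preimage_eq : (fun e => C.op s fun j => (x j).1 e) ⁻¹' {c} =
        ⋃ t ∈ {t | C.op s t = c}, ⋂ j, (x j).1 ⁻¹' {t j} := by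
      ext e
      simp only [Set.mem_iUnion, Set.mem_iInter, Set.mem_preimage, Set.mem_singleton_iff]
      exact ⟨fun h => ⟨_, h, fun _ => rfl⟩, fun ⟨t, ht, hx⟩ => funext hx ▸ ht⟩
    rw [preimage_eq]
    exact BooleanSubalgebra.biSup_mem (Set.toFinite _) fun t _ =>
      BooleanSubalgebra.iInf_mem fun j => (x j).2 (t j)⟩

section Evaluation

variable {σ : AlgType} (C : UAlg.{u} σ) [Finite C.carrier] {B : UAlg.{u} heytType}

theorem isHom_booleanPower_eval (e : DualSpace B) : IsHom (booleanPower C B) C fun f => f.1 e :=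
  fun _ _ => rfl

theorem booleanPower_mem_ISP (B : UAlg.{u} heytType) : booleanPower C B ∈ ISP C := fun _ _ h =>
  Subtype.ext (funext fun e => h _ (isHom_booleanPower_eval C e))

end Evaluation

theorem truthValue_preimage_singleton_mem_representable {C : UAlg.{u} giraleType}
    (hC : IsTwoValued C) {B : UAlg.{u} heytType} (b : B.carrier) (c : C.carrier) :
    (fun e : DualSpace B => truthValue C (e.1 b).down) ⁻¹' {c} ∈ representable B := by
  have mem : {e : DualSpace B | (e.1 b).down} ∈ representable B := mem_representable.2 ⟨b, rfl⟩
  by_cases one_eq : one C = c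
  · convert mem using 1
    exact Set.ext fun e => one_eq ▸ hC.truthValue_eq_one_iff
  by_cases bang_zero_eq : bang C (zero C) = c
  · convert BooleanSubalgebra.compl_mem mem using 1
    exact Set.ext fun e => bang_zero_eq ▸ hC.truthValue_eq_bang_zero_iff
  · convert (representable B).bot_mem using 1
    refine Set.eq_empty_of_forall_notMem fun e he => ?_
    by_cases h : (e.1 b).down
    · exact one_eq ((truthValue_of h).symm.trans he)
    · exact bang_zero_eq ((truthValue_of_not h).symm.trans he)

namespace IsTwoValued

variable {C : UAlg.{u} giraleType} (hC : IsTwoValued C) [Finite C.carrier]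
include hC

theorem iso_bangAlg_booleanPower {B : UAlg.{u} heytType} (hB : IsBooleanAlg B)
    (hP : IsGirale (booleanPower C B)) : Iso B (bangAlg (booleanPower C B) hP) := by
  have isHom_eval (e : DualSpace B) := isHom_bangAlg hP hC.girale (isHom_booleanPower_eval C e)
  let f (b : B.carrier) : (booleanPower C B).carrier :=
    ⟨fun e => truthValue C (e.1 b).down, truthValue_preimage_singleton_mem_representable hC b⟩
  have bang_f (b : B.carrier) : bang (booleanPower C B) (f b) = f b :=
    Subtype.ext (funext fun e =>
      ((isHom_booleanPower_eval C e).map_bang (f b)).trans (hC.bang_truthValue _))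
  refine ⟨fun b => ⟨f b, f b, bang_f b⟩, .of_jointly_injective isHom_eval (fun u v h => ?_)
    fun e => ?_, fun a b hab => ?_, fun ⟨u, x, hx⟩ => ?_⟩
  · exact Subtype.ext (Subtype.ext (funext fun e => congrArg Subtype.val (h e)))
  · exact hC.isHom_truthValue.comp e.2
  · refine hB.mem_ISP_propAlg a b fun e he => propAlg_ext ?_
    have truthValue_eq : truthValue C (e a).down = truthValue C (e b).down :=
      congrArg (fun u : (bangAlg (booleanPower C B) hP).carrier => u.1.1 ⟨e, he⟩) hab
    exact iff_of_eq (hC.truthValue_injective truthValue_eq)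
  · obtain ⟨b, hb⟩ := mem_representable.1 (u.2 (one C))
    refine ⟨b, Subtype.ext (Subtype.ext (funext fun e => ?_))⟩
    have hu : u.1 e = truthValue C (le C (one C) (x.1 e)) :=
      hx ▸ ((isHom_booleanPower_eval C e).map_bang x).trans (hC.bang_eq_truthValue _)
    have down_iff : (e.1 b).down ↔ u.1 e = one C := Set.ext_iff.1 hb e
    rw [hu, hC.truthValue_eq_one_iff] at down_iff
    exact (congrArg _ (propext down_iff)).trans hu.symm

theorem Heyt_V : Heyt (V C) = BooleanAlgs := by
  refine Set.Subset.antisymm (fun B ⟨A, hA, _, hiso⟩ => ?_) fun B hB => ?_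
  · obtain ⟨_, hbool⟩ := hC.isBooleanGirale_of_mem_V hA
    exact isVariety_booleanAlgs.mem_of_iso hbool hiso
  · have hP := booleanPower_mem_ISP C B
    exact ⟨_, ISP_subset_V C hP, hC.girale.of_mem_ISP hP, hC.iso_bangAlg_booleanPower hB _⟩

end IsTwoValued

/-! ## The girales `G n` -/

theorem isGirale_twoAlg : IsGirale twoAlg.{u} := by
  constructor
  case residuation =>
    rintro ⟨a⟩ ⟨b⟩ ⟨c⟩
    change (⟨_⟩ : ULift.{u} Bool) = ⟨_⟩ ↔ (⟨_⟩ : ULift.{u} Bool) = ⟨_⟩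
    rw [ULift.up_inj, ULift.up_inj]
    cases a <;> cases b <;> cases c <;> decide
  case bang_one => rfl
  case involutive | neg_eq | bang_le | one_mul | bang_bang => rintro ⟨a⟩; cases a <;> rfl
  case join_assoc | meet_assoc | mul_assoc =>
    rintro ⟨a⟩ ⟨b⟩ ⟨c⟩; cases a <;> cases b <;> cases c <;> rfl
  all_goals rintro ⟨a⟩ ⟨b⟩; cases a <;> cases b <;> rfl

theorem isTwoValued_twoAlg : IsTwoValued twoAlg.{u} where
  girale := isGirale_twoAlg
  bang_zero_ne_one h := Bool.false_ne_true (congrArg ULift.down h)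
  bang_eq := by
    rintro ⟨_ | _⟩
    · exact .inr rfl
    · exact .inl rfl

namespace GElt

variable {k l : ℕ}

protected theorem join_comm (a b : GElt.{u} k) : join a b = join b a := by grind [join]

protected theorem join_assoc (a b c : GElt.{u} k) : join (join a b) c = join a (join b c) := by
  simp only [join]; grind

protected theorem meet_comm (a b : GElt.{u} k) : meet a b = meet b a := by grind [meet]

protected theorem meet_assoc (a b c : GElt.{u} k) : meet (meet a b) c = meet a (meet b c) := by
  simp only [meet]; grind

protected theorem join_meet_self (a b : GElt.{u} k) : join a (meet a b) = a := by
  grind [join, meet]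

protected theorem meet_join_self (a b : GElt.{u} k) : meet a (join a b) = a := by
  grind [join, meet]

protected theorem mul_comm (a b : GElt.{u} k) : mul a b = mul b a := by
  cases a <;> cases b <;> simp [mul, eq_comm]

protected theorem mul_assoc (a b c : GElt.{u} k) : mul (mul a b) c = mul a (mul b c) := by
  cases a <;> cases b <;> cases c <;> simp only [mul] <;> split_ifs <;> rfl

protected theorem neg_neg (a : GElt.{u} k) : neg (neg a) = a := by cases a <;> rfl

theorem mul_le_zero_iff (a b : GElt.{u} k) :
    meet (mul a b) zero = mul a b ↔ meet a (neg b) = a := by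
  cases a <;> cases b <;> grind [mul, neg, meet]

-- Both sides say that `a · b · ¬c ≤ 0`.
protected theorem residuation (a b c : GElt.{u} k) :
    meet (mul a b) c = mul a b ↔ meet a (imp b c) = a := by
  have le_iff (x y : GElt.{u} k) : meet x y = x ↔ meet (mul x (neg y)) zero = mul x (neg y) := by
    rw [mul_le_zero_iff, GElt.neg_neg]
  rw [le_iff, imp, ← mul_le_zero_iff, GElt.mul_assoc]

theorem imp_zero (a : GElt.{u} k) : imp a zero = neg a := by cases a <;> rfl

theorem imp_imp_zero (a : GElt.{u} k) : imp (imp a zero) zero = a := by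
  rw [imp_zero, imp_zero, GElt.neg_neg]

theorem bang_le (a : GElt.{u} k) : meet (bang a) (meet a one) = bang a := by
  cases a <;> grind [meet, bang]

theorem bang_mul_bang (a b : GElt.{u} k) : mul (bang a) (bang b) = bang (meet a b) := by
  cases a <;> cases b <;> grind [meet, bang, mul]

def equivSum (k : ℕ) : GElt.{u} k ≃ Fin 4 ⊕ Fin k where
  toFun
    | bot => .inl 0
    | top => .inl 1
    | one => .inl 2
    | zero => .inl 3
    | mid i => .inr i
  invFun
    | .inl 0 => bot
    | .inl 1 => top
    | .inl 2 => one
    | .inl 3 => zero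
    | .inr i => mid i
  left_inv x := by cases x <;> rfl
  right_inv := by
    rintro (i | i)
    · fin_cases i <;> rfl
    · rfl

/-- The map induced by a map between the indices of the atoms other than `1` and `0`. -/
def map (f : Fin k → Fin l) : GElt.{u} k → GElt.{u} l
  | bot => bot
  | top => top
  | one => one
  | zero => zero
  | mid i => mid (f i)

theorem map_injective {f : Fin k → Fin l} (hf : Function.Injective f) :
    Function.Injective (map.{u} f) := by
  intro a b h
  cases a <;> cases b <;> grind [map]

theorem mid_mem_range_map {f : Fin k → Fin l} {i : Fin l} :
    mid i ∈ Set.range (map.{u} f) ↔ i ∈ Set.range f := by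
  constructor
  · rintro ⟨x, hx⟩
    cases x <;> grind [map]
  · rintro ⟨j, rfl⟩
    exact ⟨mid j, rfl⟩

theorem map_join {f : Fin k → Fin l} (hf : Function.Injective f) (a b : GElt.{u} k) :
    map f (join a b) = join (map f a) (map f b) := by
  cases a <;> cases b <;> grind [map, join]

theorem map_meet {f : Fin k → Fin l} (hf : Function.Injective f) (a b : GElt.{u} k) :
    map f (meet a b) = meet (map f a) (map f b) := by
  cases a <;> cases b <;> grind [map, meet]

theorem map_mul {f : Fin k → Fin l} (hf : Function.Injective f) (a b : GElt.{u} k) :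
    map f (mul a b) = mul (map f a) (map f b) := by
  cases a <;> cases b <;> grind [map, mul]

theorem map_neg (f : Fin k → Fin l) (a : GElt.{u} k) : map f (neg a) = neg (map f a) := by
  cases a <;> rfl

theorem map_bang (f : Fin k → Fin l) (a : GElt.{u} k) : map f (bang a) = bang (map f a) := by
  cases a <;> rfl

theorem isHom_map {f : Fin k → Fin l} (hf : Function.Injective f) :
    IsHom (G.{u} (k + 2)) (G.{u} (l + 2)) (map f) := by
  intro g x
  cases g
  · exact map_join hf _ _
  · exact map_meet hf _ _
  · exact (map_neg f _).trans
      (congrArg neg ((map_mul hf _ _).trans (congrArg _ (map_neg f _))))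
  · exact map_mul hf _ _
  · exact map_neg f _
  · rfl
  · exact map_bang f _

end GElt

theorem isGirale_G_add_two (k : ℕ) : IsGirale (G.{u} (k + 2)) where
  join_comm := GElt.join_comm (k := k)
  join_assoc := GElt.join_assoc (k := k)
  meet_comm := GElt.meet_comm (k := k)
  meet_assoc := GElt.meet_assoc (k := k)
  join_meet_self := GElt.join_meet_self (k := k)
  meet_join_self := GElt.meet_join_self (k := k)
  mul_comm := GElt.mul_comm (k := k)
  mul_assoc := GElt.mul_assoc (k := k)
  one_mul := by rintro (_ | _) <;> rfl
  residuation := GElt.residuation (k := k)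
  involutive := GElt.imp_imp_zero (k := k)
  neg_eq a := (GElt.imp_zero (k := k) a).symm
  bang_one := rfl
  bang_le := GElt.bang_le (k := k)
  bang_mul_bang := GElt.bang_mul_bang (k := k)
  bang_bang := by rintro (_ | _) <;> rfl

theorem isTwoValued_G_add_two (k : ℕ) : IsTwoValued (G.{u} (k + 2)) where
  girale := isGirale_G_add_two k
  bang_zero_ne_one h := GElt.noConfusion rfl (heq_of_eq (h : (GElt.bot : GElt.{u} k) = GElt.one))
  bang_eq := by
    rintro (_ | _ | _ | _ | i)
    · exact .inr rfl
    · exact .inl rfl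
    · exact .inl rfl
    · exact .inr rfl
    · exact .inr rfl

theorem isTwoValued_G {n : ℕ} (hn : 1 ≤ n) : IsTwoValued (G.{u} n) := by
  obtain rfl | hn := hn.eq_or_lt
  · exact isTwoValued_twoAlg
  · obtain ⟨k, rfl⟩ := Nat.exists_eq_add_of_le' hn
    exact isTwoValued_G_add_two k

instance finite_G : ∀ n, Finite (G.{u} n).carrier
  | 0 | 1 => inferInstanceAs (Finite (ULift.{u} Bool))
  | k + 2 => Finite.of_equiv _ (GElt.equivSum.{u} k).symm

theorem card_G_one : Nat.card (G.{u} 1).carrier = 2 :=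
  (Nat.card_congr Equiv.ulift).trans (by rw [Nat.card_eq_fintype_card, Fintype.card_bool])

theorem card_G {n : ℕ} (hn : 2 ≤ n) : Nat.card (G.{u} n).carrier = n + 2 := by
  obtain ⟨k, rfl⟩ := Nat.exists_eq_add_of_le' hn
  calc Nat.card (GElt.{u} k) = Nat.card (Fin 4 ⊕ Fin k) := Nat.card_congr (GElt.equivSum k)
    _ = k + 2 + 2 := by rw [Nat.card_sum, Nat.card_fin, Nat.card_fin]; omega

theorem injOn_card_G : Set.InjOn (fun n => Nat.card (G.{u} n).carrier) (Set.Ici 1) := by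
  rintro m hm n hn (h : Nat.card (G.{u} m).carrier = Nat.card (G.{u} n).carrier)
  obtain rfl | hm := (Set.mem_Ici.1 hm).eq_or_lt <;> obtain rfl | hn := (Set.mem_Ici.1 hn).eq_or_lt
  · rfl
  · rw [card_G_one, card_G hn] at h; omega
  · rw [card_G_one, card_G hm] at h; omega
  · rw [card_G hn, card_G hm] at h; omega

theorem not_iso_G {m n : ℕ} (hm : 1 ≤ m) (hn : 1 ≤ n) (hmn : m ≠ n) : ¬Iso (G.{u} m) (G.{u} n) :=
  fun h => hmn (injOn_card_G hm hn h.card_eq)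

theorem V_G_ne {m n : ℕ} (hm : 1 ≤ m) (hn : 1 ≤ n) (hmn : m ≠ n) : V (G.{u} m) ≠ V (G.{u} n) :=
  have hm' := isTwoValued_G hm
  have hn' := isTwoValued_G hn
  fun h => hmn <| injOn_card_G hm hn <|
    card_eq_of_V_eq hm'.isSimpleAlg.isSubdirectlyIrreducible
      hn'.isSimpleAlg.isSubdirectlyIrreducible hm'.V_eq_ISP hn'.V_eq_ISP h

section HomIntoG

variable {A : UAlg.{u} giraleType}

theorem IsHom.surjective_G_one {φ : A.carrier → (G.{u} 1).carrier} (h : IsHom A (G.{u} 1) φ) :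
    Function.Surjective φ := by
  rintro ⟨_ | _⟩
  · exact ⟨zero A, h.map_zero⟩
  · exact ⟨one A, h.map_one⟩

-- The remaining elements of `G (k + 2)` are the values of the constant terms
-- `!0`, `¬!0`, `1` and `0`.
theorem IsHom.mem_range_of_forall_ne_mid {k : ℕ} {φ : A.carrier → GElt.{u} k}
    (h : IsHom A (G.{u} (k + 2)) φ) {x : GElt.{u} k} (hx : ∀ i, x ≠ .mid i) :
    x ∈ Set.range φ := by
  have map_bang_zero : φ (bang A (zero A)) = .bot :=
    (h.map_bang _).trans (congrArg (bang (G (k + 2))) h.map_zero)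
  cases x with
  | bot => exact ⟨_, map_bang_zero⟩
  | top => exact ⟨_, (h.map_neg _).trans (congrArg GElt.neg map_bang_zero)⟩
  | one => exact ⟨_, h.map_one⟩
  | zero => exact ⟨_, h.map_zero⟩
  | mid i => exact (hx i rfl).elim

theorem IsHom.surjective_G_two {φ : A.carrier → (G.{u} 2).carrier} (h : IsHom A (G.{u} 2) φ) :
    Function.Surjective φ := fun _ => h.mem_range_of_forall_ne_mid fun i => i.elim0

theorem IsHom.exists_iso_G {k : ℕ} {φ : A.carrier → GElt.{u} k} (h : IsHom A (G.{u} (k + 2)) φ)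
    (inj : Function.Injective φ) : ∃ m, 2 ≤ m ∧ m ≤ k + 2 ∧ Iso A (G.{u} m) := by
  let M : Set (Fin k) := {i | .mid i ∈ Set.range φ}
  let f : Fin (Nat.card M) → Fin k := Subtype.val ∘ (Finite.equivFin M).symm
  have inj_f : Function.Injective f := Subtype.val_injective.comp (Equiv.injective _)
  have range_f : Set.range f = M := by rw [EquivLike.range_comp, Subtype.range_coe]
  have card_le : Nat.card M ≤ k := by
    simpa only [Nat.card_fin] using Nat.card_le_card_of_injective f inj_f
  refine ⟨Nat.card M + 2, by omega, by omega, iso_of_range_eq h inj (GElt.isHom_map inj_f)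
    (GElt.map_injective inj_f) (Set.ext fun x => ?_)⟩
  by_cases hx : ∃ i, x = .mid i
  · obtain ⟨i, rfl⟩ := hx
    exact (Set.ext_iff.1 range_f i).symm.trans GElt.mid_mem_range_map.symm
  · rw [not_exists] at hx
    exact iff_of_true (h.mem_range_of_forall_ne_mid hx)
      ((GElt.isHom_map inj_f).mem_range_of_forall_ne_mid hx)

theorem exists_embedding_G_iff {n : ℕ} (hn : 2 ≤ n) :
    (∃ φ, IsHom A (G.{u} n) φ ∧ Function.Injective φ) ↔
      ∃ m, 2 ≤ m ∧ m ≤ n ∧ Iso A (G.{u} m) := by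
  obtain ⟨k, rfl⟩ := Nat.exists_eq_add_of_le' hn
  constructor
  · rintro ⟨φ, hφ, inj⟩
    exact hφ.exists_iso_G inj
  · rintro ⟨m, hm, hmk, φ, hφ, bij⟩
    obtain ⟨l, rfl⟩ := Nat.exists_eq_add_of_le' hm
    have inj := Fin.castLE_injective (Nat.le_of_add_le_add_right hmk)
    exact ⟨_, (GElt.isHom_map inj).comp hφ, (GElt.map_injective inj).comp bij.injective⟩

theorem exists_embedding_G_one_iff :
    (∃ φ, IsHom A (G.{u} 1) φ ∧ Function.Injective φ) ↔ Iso A (G.{u} 1) :=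
  exists_congr fun _ => and_congr_right fun hφ =>
    ⟨fun inj => ⟨inj, hφ.surjective_G_one⟩, fun bij => bij.injective⟩

end HomIntoG

theorem isAtomVariety_V_G_one : IsAtomVariety (V (G.{u} 1)) :=
  have hG := isTwoValued_G.{u} le_rfl
  have := hG.nontrivial
  isAtomVariety_V hG.V_eq_ISP fun _ _ => IsHom.surjective_G_one

theorem isAtomVariety_V_G_two : IsAtomVariety (V (G.{u} 2)) :=
  have hG := isTwoValued_G.{u} one_le_two
  have := hG.nontrivial
  isAtomVariety_V hG.V_eq_ISP fun _ _ => IsHom.surjective_G_two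

theorem V_G_one_inter_V_G_two : V (G.{u} 1) ∩ V (G.{u} 2) = trivialClass giraleType :=
  isAtomVariety_V_G_one.inter_eq_trivialClass isAtomVariety_V_G_two
    (V_G_ne le_rfl one_le_two (Nat.succ_ne_self 1).symm)

theorem isGirale_of_subsingleton {A : UAlg.{u} giraleType} [Subsingleton A.carrier] :
    IsGirale A :=
  isGirale_twoAlg.of_mem_ISP fun _ _ _ => Subsingleton.elim _ _

theorem Heyt_trivialClass : Heyt (trivialClass.{u} giraleType) = trivialClass heytType := by
  refine Set.Subset.antisymm ?_ fun B (hB : Subsingleton B.carrier) => ?_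
  · rintro B ⟨A, hA : Subsingleton A.carrier, _, φ, _, bij⟩
    exact ⟨fun _ _ => bij.injective (Subtype.ext (Subsingleton.elim _ _))⟩
  · let T : UAlg.{u} giraleType := ⟨PUnit, fun _ _ => PUnit.unit⟩
    have hT : Subsingleton T.carrier := inferInstanceAs (Subsingleton PUnit)
    exact ⟨T, hT, isGirale_of_subsingleton, fun _ => hone _,
      fun _ _ => Subtype.ext (Subsingleton.elim _ _), fun _ _ _ => Subsingleton.elim _ _,
      fun _ => ⟨hone B, Subtype.ext (Subsingleton.elim _ _)⟩⟩

theorem Heyt_V_G {n : ℕ} (hn : 1 ≤ n) : Heyt (V (G.{u} n)) = BooleanAlgs :=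
  (isTwoValued_G hn).Heyt_V

theorem Heyt_V_G_one_inter_V_G_two_ne :
    Heyt (V (G.{u} 1) ∩ V (G.{u} 2)) ≠ Heyt (V (G.{u} 1)) ∩ Heyt (V (G.{u} 2)) := by
  rw [Heyt_V_G le_rfl, Heyt_V_G one_le_two, Set.inter_self, V_G_one_inter_V_G_two,
    Heyt_trivialClass]
  exact booleanAlgs_ne_trivialClass.symm

end Girales

theorem mainTheorem8 :
    -- every `G n` is a finite simple Boolean girale; the number of elements is unbounded
    (∀ n : ℕ, 1 ≤ n →
      IsBooleanGirale (Girales.G.{u} n) ∧ IsSimpleAlg (Girales.G.{u} n) ∧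
        Finite (Girales.G.{u} n).carrier) ∧
    (∀ n : ℕ, 2 ≤ n → Nat.card (Girales.G.{u} n).carrier = n + 2) ∧
    -- `V(G n)` is a Boolean variety of girales
    (∀ n : ℕ, 1 ≤ n →
      IsGiraleVariety (Girales.V (Girales.G.{u} n)) ∧
        ∀ A ∈ Girales.V (Girales.G.{u} n), IsBooleanGirale A) ∧
    -- the subdirectly irreducible algebras in `V(G n)`
    (∀ n : ℕ, 2 ≤ n → ∀ A : UAlg.{u} giraleType,
      (A ∈ Girales.V (Girales.G.{u} n) ∧ IsSubdirectlyIrreducible A) ↔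
        ∃ m : ℕ, 2 ≤ m ∧ m ≤ n ∧ Girales.Iso A (Girales.G.{u} m)) ∧
    (∀ A : UAlg.{u} giraleType,
      (A ∈ Girales.V (Girales.G.{u} 1) ∧ IsSubdirectlyIrreducible A) ↔
        Girales.Iso A (Girales.G.{u} 1)) ∧
    -- the `G n` are pairwise nonisomorphic and generate distinct varieties
    (∀ m n : ℕ, 1 ≤ m → 1 ≤ n → m ≠ n →
      ¬ Girales.Iso (Girales.G.{u} m) (Girales.G.{u} n) ∧
        Girales.V (Girales.G.{u} m) ≠ Girales.V (Girales.G.{u} n)) ∧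
    -- `V(G 1)` and `V(G 2)` are atoms with trivial intersection, but have the same `Heyt` image
    IsAtomVariety (Girales.V (Girales.G.{u} 1)) ∧
    IsAtomVariety (Girales.V (Girales.G.{u} 2)) ∧
    Girales.V (Girales.G.{u} 1) ∩ Girales.V (Girales.G.{u} 2) = trivialClass giraleType ∧
    IsVariety BooleanAlgs.{u} ∧
    Heyt (Girales.V (Girales.G.{u} 1)) = BooleanAlgs ∧
    Heyt (Girales.V (Girales.G.{u} 2)) = BooleanAlgs ∧
    Heyt (Girales.V (Girales.G.{u} 1) ∩ Girales.V (Girales.G.{u} 2)) = trivialClass heytType ∧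
    Heyt (Girales.V (Girales.G.{u} 1) ∩ Girales.V (Girales.G.{u} 2)) ≠
      Heyt (Girales.V (Girales.G.{u} 1)) ∩ Heyt (Girales.V (Girales.G.{u} 2)) ∧
    -- `Heyt` is not a meet-homomorphism
    ¬ (∀ K L : Set (UAlg.{u} giraleType), IsGiraleVariety K → IsGiraleVariety L →
      Heyt (K ∩ L) = Heyt K ∩ Heyt L) := by
  refine ⟨fun n hn => ⟨(isTwoValued_G hn).isBooleanGirale, (isTwoValued_G hn).isSimpleAlg,
      finite_G n⟩,
    fun n hn => card_G hn,
    fun n hn => ⟨(isTwoValued_G hn).isGiraleVariety_V,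
      fun _ => (isTwoValued_G hn).isBooleanGirale_of_mem_V⟩,
    fun n hn A => (isTwoValued_G (one_le_two.trans hn)).mem_V_and_isSubdirectlyIrreducible_iff.trans
      (exists_embedding_G_iff hn),
    fun A => (isTwoValued_G le_rfl).mem_V_and_isSubdirectlyIrreducible_iff.trans
      exists_embedding_G_one_iff,
    fun m n hm hn hmn => ⟨not_iso_G hm hn hmn, V_G_ne hm hn hmn⟩,
    isAtomVariety_V_G_one, isAtomVariety_V_G_two, V_G_one_inter_V_G_two, isVariety_booleanAlgs,
    Heyt_V_G le_rfl, Heyt_V_G one_le_two, ?_, Heyt_V_G_one_inter_V_G_two_ne,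
    fun h => Heyt_V_G_one_inter_V_G_two_ne (h _ _ (isTwoValued_G le_rfl).isGiraleVariety_V
      (isTwoValued_G one_le_two).isGiraleVariety_V)⟩
  rw [V_G_one_inter_V_G_two, Heyt_trivialClass]
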